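/- Let $T$ be a complete consistent first-order theory and let $M$ be a big model of $T$: for some uncountable strong limit cardinal $\kappa$ larger than the cardinality of the language, $M$ is $\kappa$-saturated and strongly $\kappa$-homogeneous (every partial elementary map of $M$ whose domain has fewer than $\kappa$ elements extends to an automorphism of $M$). A subset of $M$ is called small if it has fewer than $\kappa$ elements. For $A\subseteq M$ let $\operatorname{acl}A$ be the set of elements of $M$ that satisfy some formula with parameters in $A$ having only finitely many solutions in $M$; write $AB$ for $A\cup B$, and write $A\equiv_BA'$ if some automorphism of $M$ fixes $B$ pointwise and maps the set $A$ onto the set $A'$. M-dividing independence is the ternary relation $$A\mathop{\perp}^{M}_{C}B\iff \operatorname{acl}(AC')\cap\operatorname{acl}(BC')=\operatorname{acl}C'\ \text{ for all } C' \text{ with } C\subseteq C'\subseteq\operatorname{acl}(BC).$$ A ternary relation $A\perp_CB$ between small subsets of $M$ is an independence relation if the following hold for all small sets: - (invariance) if $A\perp_CB$ and $\sigma$ is an automorphism of $M$, then $\sigma(A)\perp_{\sigma(C)}\sigma(B)$; - (monotonicity) if $A\perp_CB$, $A'\subseteq A$ and $B'\subseteq B$, then $A'\perp_CB'$; - (base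 monotonicity) if $D\subseteq C\subseteq B$ and $A\perp_DB$, then $A\perp_CB$; - (transitivity) if $D\subseteq C\subseteq B$, $B\perp_CA$ and $C\perp_DA$, then $B\perp_DA$; - (normality) if $A\perp_CB$, then $AC\perp_CB$; - (extension) if $A\perp_CB$ and $\hat B\supseteq B$, then there is $A'\equiv_{BC}A$ such that $A'\perp_C\hat B$; - (finite character) if $A_0\perp_CB$ for all finite $A_0\subseteq A$, then $A\perp_CB$; - (local character) for every $A$ there is a cardinal $\kappa(A)<\kappa$ such that for every $B$ there is $C\subseteq B$ with $|C|<\kappa(A)$ and $A\perp_CB$. It is strict if moreover (anti-reflexivity) $\{a\}\perp_B\{a\}$ implies $a\in\operatorname{acl}B$. It is symmetric if $A\perp_CB\iff B\perp_CA$ for all small $A,B,C$. Theorem. The relation $\perp^{M}$ on small subsets of $M$ is an independence relation if and only if it is symmetric; likewise, $\perp^{M}$ is a strict independence relation if and only if it is symmetric. -/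

import Mathlib

open FirstOrder

universe u v w

namespace ModelIndep

section

variable (L : FirstOrder.Language.{u, v})

/-- `M` is `κ`-saturated: every set of formulas in one variable over fewer than `κ` parameters which
is finitely satisfiable in `M` is realised in `M`. -/
def IsSaturated (κ : Cardinal.{w}) (M : Type w) [L.Structure M] : Prop :=
  ∀ A : Set M, Cardinal.mk A < κ → ∀ p : Set (L[[A]].Formula Unit),
    (∀ p₀ : Finset (L[[A]].Formula Unit), (p₀ : Set (L[[A]].Formula Unit)) ⊆ p →
      ∃ a : M, ∀ φ ∈ p₀, φ.Realize (fun _ => a)) →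
    ∃ a : M, ∀ φ ∈ p, φ.Realize (fun _ => a)

/-- `M` is strongly `κ`-homogeneous: every partial elementary map of `M` with a domain of fewer
than `κ` elements extends to an automorphism of `M`. -/
def IsStronglyHomogeneous (κ : Cardinal.{w}) (M : Type w) [L.Structure M] : Prop :=
  ∀ A : Set M, Cardinal.mk A < κ → ∀ f : A → M,
    (∀ φ : L.Formula A, φ.Realize (fun a : A => (a : M)) ↔ φ.Realize f) →
    ∃ σ : M ≃[L] M, ∀ a : A, σ a = f a

/-- `M` is a big model, relative to the cardinal `κ`: `κ` is an uncountable strong limit cardinal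
larger than the language, and `M` is `κ`-saturated and strongly `κ`-homogeneous. The small subsets of
`M` are those with fewer than `κ` elements. -/
structure IsBigModel (κ : Cardinal.{w}) (M : Type w) [L.Structure M] : Prop where
  aleph0_lt : Cardinal.aleph0 < κ
  strongLimit : κ.IsStrongLimit
  card_lt : Cardinal.lift.{w} L.card < Cardinal.lift.{max u v} κ
  saturated : IsSaturated L κ M
  homogeneous : IsStronglyHomogeneous L κ M

variable {M : Type w} [L.Structure M]

/-- The algebraic closure of `A` in `M`: the elements lying in a finite `A`-definable subset of `M`,
that is, the elements satisfying a formula over `A` that has only finitely many solutions. -/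
def acl (A : Set M) : Set M :=
  {a | ∃ s : Set M, A.Definable₁ L s ∧ s.Finite ∧ a ∈ s}

/-- M-dividing independence; `MIndep L A C B` is "`A` is independent from `B` over `C`". -/
def MIndep (A C B : Set M) : Prop :=
  ∀ C' : Set M, C ⊆ C' → C' ⊆ acl L (B ∪ C) →
    acl L (A ∪ C') ∩ acl L (B ∪ C') = acl L C'

/-- The axioms for independence relations, for a ternary relation `I` on the small subsets of `M`;
`I A C B` is "`A` is independent from `B` over `C`". -/
structure IsIndependenceRelation (κ : Cardinal.{w})
    (I : Set M → Set M → Set M → Prop) : Prop where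
  invariance : ∀ A B C : Set M,
    Cardinal.mk A < κ → Cardinal.mk B < κ → Cardinal.mk C < κ →
    ∀ σ : M ≃[L] M, I A C B → I (σ '' A) (σ '' C) (σ '' B)
  monotonicity : ∀ A B C A' B' : Set M,
    Cardinal.mk A < κ → Cardinal.mk B < κ → Cardinal.mk C < κ →
    A' ⊆ A → B' ⊆ B → I A C B → I A' C B'
  base_monotonicity : ∀ A B C D : Set M,
    Cardinal.mk A < κ → Cardinal.mk B < κ →
    D ⊆ C → C ⊆ B → I A D B → I A C B
  transitivity : ∀ A B C D : Set M,
    Cardinal.mk A < κ → Cardinal.mk B < κ →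
    D ⊆ C → C ⊆ B → I B C A → I C D A → I B D A
  normality : ∀ A B C : Set M,
    Cardinal.mk A < κ → Cardinal.mk B < κ → Cardinal.mk C < κ →
    I A C B → I (A ∪ C) C B
  extension : ∀ A B C B' : Set M,
    Cardinal.mk A < κ → Cardinal.mk B' < κ → Cardinal.mk C < κ →
    B ⊆ B' → I A C B →
    ∃ σ : M ≃[L] M, (∀ x ∈ B ∪ C, σ x = x) ∧ I (σ '' A) C B'
  finite_character : ∀ A B C : Set M,
    Cardinal.mk A < κ → Cardinal.mk B < κ → Cardinal.mk C < κ →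
    (∀ A₀ : Set M, A₀ ⊆ A → A₀.Finite → I A₀ C B) → I A C B
  /-- The bound depends on `A` only, and is itself small. -/
  local_character : ∀ A : Set M, Cardinal.mk A < κ →
    ∃ μ : Cardinal.{w}, μ < κ ∧ ∀ B : Set M, Cardinal.mk B < κ →
      ∃ C : Set M, C ⊆ B ∧ Cardinal.mk C < μ ∧ I A C B

/-- A strict independence relation is one that also satisfies anti-reflexivity. -/
structure IsStrictIndependenceRelation (κ : Cardinal.{w})
    (I : Set M → Set M → Set M → Prop) : Prop extends IsIndependenceRelation L κ I where
  anti_reflexivity : ∀ (a : M) (B : Set M), Cardinal.mk B < κ →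
    I {a} B {a} → a ∈ acl L B

end

/-- Symmetry of a ternary relation on the small subsets of `M`. -/
def IsSymmetric {M : Type w} (κ : Cardinal.{w}) (I : Set M → Set M → Set M → Prop) : Prop :=
  ∀ A B C : Set M, Cardinal.mk A < κ → Cardinal.mk B < κ → Cardinal.mk C < κ →
    (I A C B ↔ I B C A)

end ModelIndep

/-! Every independence relation is symmetric, by a long-sequence argument
(`IsIndependenceRelation.symm`). Given `A` independent from `B` over `C`, extension yields
conjugates of `A` over `BC`, indexed by a regular cardinal above the local character bound of `B`,
with the union of the earlier ones independent over `C` from each new one together with `BC`. Local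
character gives a base for `B` lying in `C` and a proper initial segment; the next conjugate is then
independent from `B` in the reversed direction by transitivity, and an automorphism carries this
back to `A`.

Conversely, M-dividing independence always satisfies every axiom except possibly local character and
extension, and it is anti-reflexive. If it is symmetric, local character can be proved with the
sides exchanged, by closing a subset of `B` under finite witnesses of algebraicity
(`IsSymmetric.local_character`).

Local character in turn yields full existence (`exists_equiv_mIndep`): some conjugate of `A` over
`C` is independent from `B`. Otherwise, by compactness, finitely many algebraic relations witness
dependence for all conjugates. Copies of `acl(BC)` can then be arranged in finite chains, where each
copy has an element algebraic over `A` and its own base but not over that base and the earlier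
copies. A compactness limit of regular length contradicts local character (`false_of_chain`).
Extension follows from full existence by symmetry and transitivity. -/

namespace ModelIndep

open Set

section
variable {L : FirstOrder.Language.{u, v}} {M : Type w} [L.Structure M]

/-! ### Definable sets in arbitrarily many variables -/

/-- A definable set depends on finitely many coordinates only. -/
theorem Definable.exists_finset {ι : Type*} {A : Set M} {D : Set (ι → M)} (hD : A.Definable L D) :
    ∃ s : Finset ι, ∃ D' : Set (s → M), A.Definable L D' ∧ D = {v | (fun i : s => v i) ∈ D'} := by
  classical
  obtain ⟨φ, rfl⟩ := hD
  refine ⟨φ.freeVarFinset, {v | Language.Formula.Realize (φ.restrictFreeVar id) v},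
    ⟨φ.restrictFreeVar id, rfl⟩, ?_⟩
  ext v
  exact (Language.BoundedFormula.realize_restrictFreeVar (φ := φ) (f := id)
    (v := fun a => v a) v (by simp)).symm

theorem Definable.exists_finset_congr {ι : Type*} {A : Set M} {D : Set (ι → M)}
    (hD : A.Definable L D) :
    ∃ s : Finset ι, ∀ v v' : ι → M, (∀ i ∈ s, v i = v' i) → v ∈ D → v' ∈ D := by
  obtain ⟨s, D', -, rfl⟩ := Definable.exists_finset hD
  refine ⟨s, fun v v' h hv => ?_⟩
  have : (fun i : s => v i) = fun i : s => v' i := funext fun i => h i i.2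
  simpa only [mem_ofPred_eq, this] using hv

theorem definable₁_iff {A S : Set M} {β : Type*} [Unique β] :
    A.Definable₁ L S ↔ A.Definable L {x : β → M | x default ∈ S} := by
  constructor
  · intro h
    exact h.preimage_comp (fun _ : Fin 1 => (default : β))
  · intro h
    have := h.preimage_comp (fun _ : β => (0 : Fin 1))
    exact this

theorem Definable.eval_image {ι : Type*} {A : Set M} {D : Set (ι → M)}
    (hD : A.Definable L D) (i : ι) : A.Definable₁ L ((fun v => v i) '' D) := by
  classical
  obtain ⟨s, D', hD', rfl⟩ := Definable.exists_finset hD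
  let t : Finset ι := insert i s
  have h1 := hD'.preimage_comp (fun j : s => (⟨j, Finset.mem_insert_of_mem j.2⟩ : t))
  have h2 := h1.image_comp (fun _ : Fin 1 => (⟨i, Finset.mem_insert_self i s⟩ : t))
  have : {x : Fin 1 → M | x 0 ∈ (fun v : ι → M => v i) '' {v | (fun j : s => v j) ∈ D'}} =
      (fun g : t → M => g ∘ fun _ : Fin 1 => (⟨i, Finset.mem_insert_self i s⟩ : t)) ''
      ((fun g : t → M => g ∘ (fun j : s => (⟨j, Finset.mem_insert_of_mem j.2⟩ : t))) ⁻¹' D') := by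
    ext x
    constructor
    · rintro ⟨v, hv, hx⟩
      refine ⟨fun j => v j, hv, ?_⟩
      funext k
      rw [Subsingleton.elim k 0]
      exact hx
    · rintro ⟨g, hg, rfl⟩
      refine ⟨fun j => if h : j ∈ t then g ⟨j, h⟩ else g ⟨i, Finset.mem_insert_self i s⟩, ?_, ?_⟩
      · have : (fun j : s => (if h : (j : ι) ∈ t then g ⟨j, h⟩
            else g ⟨i, Finset.mem_insert_self i s⟩)) =
            g ∘ (fun j : s => (⟨j, Finset.mem_insert_of_mem j.2⟩ : t)) := by
          funext j
          rw [dif_pos (Finset.mem_insert_of_mem j.2)]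
          rfl
        rw [mem_ofPred_eq, this]
        exact hg
      · simp [t]
  rw [Definable₁, this]
  exact h2

theorem definable_eq {ι : Type*} (A : Set M) (i j : ι) :
    A.Definable L {v : ι → M | v i = v j} :=
  ⟨(Language.Term.var i).equal (Language.Term.var j), by ext; simp⟩

theorem definable_eval {ι : Type*} {A S : Set M} (h : A.Definable₁ L S) (i : ι) :
    A.Definable L {v : ι → M | v i ∈ S} :=
  h.preimage_comp (fun _ : Fin 1 => i)

theorem definable_eval_eq {ι : Type*} {A : Set M} {m : M} (hm : m ∈ A) (i : ι) :
    A.Definable L {v : ι → M | v i = m} :=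
  definable_eval (Set.Definable.singleton_of_mem L hm) i

/-- Replacing some of the parameters of a definable set by variables. -/
theorem Definable.exists_uncurry {ι β : Type*} {A : Set M} {c : ι → M} {D : Set (β → M)}
    (hD : (A ∪ range c).Definable L D) :
    ∃ E : Set (ι ⊕ β → M), A.Definable L E ∧ D = {x | Sum.elim c x ∈ E} := by
  classical
  obtain ⟨φ, rfl⟩ := Set.definable_iff_exists_formula_sum.1 hD
  have hg : ∀ p : ↥(A ∪ range c), ∃ q : A ⊕ ι, Sum.elim (↑) c q = (p : M) := by
    rintro ⟨p, hp | ⟨i, rfl⟩⟩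
    · exact ⟨Sum.inl ⟨p, hp⟩, rfl⟩
    · exact ⟨Sum.inr i, rfl⟩
  choose g hg using hg
  let g' : ↥(A ∪ range c) ⊕ β → A ⊕ (ι ⊕ β) :=
    Sum.elim (fun p => Sum.elim Sum.inl (fun i => Sum.inr (Sum.inl i)) (g p))
      (fun b => Sum.inr (Sum.inr b))
  refine ⟨{v | (φ.relabel g').Realize (Sum.elim (↑) v)},
    Set.definable_iff_exists_formula_sum.2 ⟨_, rfl⟩, ?_⟩
  ext x
  simp only [mem_ofPred_eq, Language.Formula.realize_relabel]
  have : (Sum.elim ((↑) : A → M) (Sum.elim c x)) ∘ g' = Sum.elim (↑) x := by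
    funext p
    rcases p with p | b
    · have := hg p
      simp only [g', Function.comp_apply, Sum.elim_inl]
      rcases h : g p with q | q <;> rw [h] at this <;> simpa using this
    · rfl
  rw [this]

theorem Definable.curry {ι β : Type*} {A : Set M} (c : ι → M) {E : Set (ι ⊕ β → M)}
    (hE : A.Definable L E) : (A ∪ range c).Definable L {x : β → M | Sum.elim c x ∈ E} := by
  obtain ⟨φ, rfl⟩ := Set.definable_iff_exists_formula_sum.1 hE
  refine Set.definable_iff_exists_formula_sum.2
    ⟨φ.relabel (Sum.elim (fun a : A => Sum.inl ⟨(a : M), Or.inl a.2⟩)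
      (Sum.elim (fun i => Sum.inl ⟨c i, Or.inr ⟨i, rfl⟩⟩) Sum.inr)), ?_⟩
  ext x
  simp only [mem_ofPred_eq, Language.Formula.realize_relabel]
  congr! 1
  funext p
  rcases p with p | p | p <;> rfl

/-- The complement asserts the existence of `n + 1` distinct points in the fibre, which is a
first-order condition. -/
theorem definable_encard_le {ι : Type*} {A : Set M} {E : Set (ι ⊕ Unit → M)}
    (hE : A.Definable L E) (n : ℕ) :
    A.Definable L {v : ι → M | {y : M | Sum.elim v (fun _ => y) ∈ E}.encard ≤ n} := by
  classical
  have h1 : A.Definable L {x : ι ⊕ Fin (n + 1) → M |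
      ∀ i j : Fin (n + 1), i ≠ j → x (Sum.inr i) ≠ x (Sum.inr j)} := by
    have : {x : ι ⊕ Fin (n + 1) → M |
        ∀ i j : Fin (n + 1), i ≠ j → x (Sum.inr i) ≠ x (Sum.inr j)} =
        ⋂ i : Fin (n + 1), ⋂ j : {j : Fin (n + 1) // i ≠ j},
          {x : ι ⊕ Fin (n + 1) → M | x (Sum.inr i) = x (Sum.inr j)}ᶜ := by
      ext x; simp
    rw [this]
    exact definable_iInter_of_finite fun i => definable_iInter_of_finite fun j =>
      (definable_eq A _ _).compl
  have h2 : A.Definable L {x : ι ⊕ Fin (n + 1) → M |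
      ∀ i : Fin (n + 1), x ∘ Sum.elim Sum.inl (fun _ : Unit => Sum.inr i) ∈ E} := by
    have : {x : ι ⊕ Fin (n + 1) → M |
        ∀ i : Fin (n + 1), x ∘ Sum.elim Sum.inl (fun _ : Unit => Sum.inr i) ∈ E} =
        ⋂ i : Fin (n + 1), (fun x : ι ⊕ Fin (n + 1) → M =>
          x ∘ Sum.elim Sum.inl (fun _ : Unit => Sum.inr i)) ⁻¹' E := by
      ext x; simp
    rw [this]
    exact definable_iInter_of_finite fun i => hE.preimage_comp _
  have h3 := (h1.inter h2).exists_of_finite.compl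
  convert h3 using 1
  ext v
  have key : ∀ u : Fin (n + 1) → M, ∀ i, (Sum.elim v u) ∘
      Sum.elim Sum.inl (fun _ : Unit => Sum.inr i) = Sum.elim v (fun _ => u i) := by
    intro u i
    funext p
    rcases p with p | p <;> rfl
  simp only [mem_ofPred_eq, mem_compl_iff, mem_inter_iff, Sum.elim_inr, key]
  constructor
  · rintro hle ⟨u, hu, hu'⟩
    have hinj : Function.Injective u := fun i j h => by
      by_contra hne
      exact hu i j hne h
    have : (range u).encard ≤ n :=
      (encard_le_encard (by rintro _ ⟨i, rfl⟩; exact hu' i)).trans hle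
    rw [← image_univ, hinj.encard_image, encard_univ, ENat.card_eq_coe_fintype_card,
      Fintype.card_fin] at this
    have := ENat.natCast_le_natCast.1 this
    omega
  · intro h
    by_contra hlt
    have hle : ((n + 1 : ℕ) : ℕ∞) ≤ {y : M | Sum.elim v (fun _ => y) ∈ E}.encard := by
      rw [Nat.cast_add, Nat.cast_one]
      exact Order.add_one_le_of_lt (not_le.1 hlt)
    obtain ⟨t, ht, htc⟩ := exists_subset_encard_eq hle
    have htf : t.Finite := finite_of_encard_eq_coe htc
    have hc : Nat.card t = n + 1 := by
      have : t.ncard = n + 1 := by rw [ncard, htc]; rfl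
      simpa using this
    have := htf.to_subtype
    let e := (Finite.equivFinOfCardEq hc).symm
    refine h ⟨fun i => e i, fun i j hij he => hij (e.injective (Subtype.ext he)),
      fun i => ht (e i).2⟩

/-! ### Algebraic closure -/

/-- Algebraicity over parameters `c` in terms of a definable relation with uniformly finite
fibres. -/
theorem mem_acl_union_range {ι : Type*} {A : Set M} {c : ι → M} {a : M} :
    a ∈ acl L (A ∪ range c) ↔ ∃ (E : Set (ι ⊕ Unit → M)) (n : ℕ), A.Definable L E ∧
      (∀ v : ι → M, {y : M | Sum.elim v (fun _ => y) ∈ E}.encard ≤ n) ∧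
      Sum.elim c (fun _ => a) ∈ E := by
  constructor
  · rintro ⟨s, hs, hfin, ha⟩
    obtain ⟨E, hE, hs'⟩ := Definable.exists_uncurry (definable₁_iff (β := Unit).1 hs)
    have hsE : s = {y | Sum.elim c (fun _ => y) ∈ E} := by
      ext y
      have := congrArg (fun S : Set (Unit → M) => (fun _ => y) ∈ S) hs'
      simpa using this
    obtain ⟨n, hn⟩ := hfin.exists_encard_eq_coe
    -- Parameters whose fibre has more than `n` points are discarded; the fibre over `c` is
    -- unaffected, and the bound now holds everywhere.
    refine ⟨E ∩ {x | x ∘ Sum.inl ∈ {v : ι → M |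
      {y : M | Sum.elim v (fun _ => y) ∈ E}.encard ≤ n}}, n,
      hE.inter ((definable_encard_le hE n).preimage_comp Sum.inl), fun v => ?_, ?_, ?_⟩
    · by_cases hv : {y : M | Sum.elim v (fun _ => y) ∈ E}.encard ≤ n
      · exact (encard_le_encard fun y hy => hy.1).trans hv
      · rw [show {y : M | Sum.elim v (fun _ => y) ∈ E ∩ {x | x ∘ Sum.inl ∈ {v : ι → M |
          {y : M | Sum.elim v (fun _ => y) ∈ E}.encard ≤ n}}} = ∅ from
          eq_empty_of_forall_notMem fun y hy => hv (by simpa using hy.2)]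
        simp
    · rw [hsE] at ha; exact ha
    · simp only [mem_ofPred_eq, Sum.elim_comp_inl, ← hsE, hn, le_refl]
  · rintro ⟨E, n, hE, hn, ha⟩
    refine ⟨{y | Sum.elim c (fun _ => y) ∈ E}, (definable₁_iff (β := Unit)).2 ?_,
      finite_of_encard_le_coe (hn c), ha⟩
    have := Definable.curry c hE
    convert this using 1
    ext x
    exact Iff.of_eq (congrArg (fun f => Sum.elim c f ∈ E) (funext fun _ => rfl))

theorem subset_acl (A : Set M) : A ⊆ acl L A := fun a ha =>
  ⟨{a}, Set.Definable.singleton_of_mem L ha, finite_singleton a, rfl⟩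

theorem acl_mono {A B : Set M} (h : A ⊆ B) : acl L A ⊆ acl L B := by
  rintro a ⟨s, hs, hfin, ha⟩
  exact ⟨s, hs.mono h, hfin, ha⟩

theorem exists_finite_of_mem_acl {A : Set M} {a : M} (h : a ∈ acl L A) :
    ∃ F ⊆ A, F.Finite ∧ a ∈ acl L F := by
  obtain ⟨s, hs, hfin, ha⟩ := h
  obtain ⟨F, hF, hd⟩ := Set.definable_iff_finitely_definable.1 hs
  exact ⟨F, hF, F.finite_toSet, s, hd, hfin, ha⟩

/-- Only finitely many algebraic parameters matter. Letting each range over its finite `A`-definable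
set keeps the union of the fibres finite, because the fibres of `E` are bounded uniformly and not
just at the original parameters. -/
theorem acl_acl (A : Set M) : acl L (acl L A) = acl L A := by
  refine Subset.antisymm (fun b hb => ?_) (subset_acl _)
  have hb' : b ∈ acl L (∅ ∪ range (Subtype.val : acl L A → M)) := by
    rwa [empty_union, Subtype.range_coe]
  obtain ⟨E, n, hE, hn, hbE⟩ := mem_acl_union_range.1 hb'
  obtain ⟨s, hs⟩ := Definable.exists_finset_congr hE
  choose S hSd hSf hS using fun c : acl L A => c.2
  let t : Set (acl L A) := {c | Sum.inl c ∈ s}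
  have ht : t.Finite := (s.finite_toSet).preimage Sum.inl_injective.injOn
  have := ht.to_subtype
  let D : Set (acl L A ⊕ Unit → M) := E ∩ ⋂ c : t, {x | x (Sum.inl c) ∈ S c}
  have hD : A.Definable L D := (hE.mono (empty_subset _)).inter
    (definable_iInter_of_finite fun c => definable_eval (hSd c) _)
  refine ⟨_, Definable.eval_image hD (Sum.inr ()), ?_, Sum.elim Subtype.val (fun _ => b),
    ⟨hbE, mem_iInter.2 fun c => hS c⟩, rfl⟩
  have hpi : {g : t → M | ∀ c : t, g c ∈ S c.1}.Finite := Set.Finite.pi' fun c => hSf c.1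
  -- Coordinates outside `t` get a default value, which is harmless since `E` looks only at the
  -- coordinates in `s`.
  refine (hpi.biUnion (t := fun g => {y | Sum.elim (fun c : acl L A =>
    by classical exact if h : c ∈ t then g ⟨c, h⟩ else c.1) (fun _ => y) ∈ E})
    fun g _ => finite_of_encard_le_coe (hn _)).subset ?_
  rintro _ ⟨x, ⟨hxE, hxS⟩, rfl⟩
  refine mem_biUnion (x := fun c : t => x (Sum.inl c)) (fun c => mem_iInter.1 hxS c) ?_
  refine hs x _ (fun i hi => ?_) hxE
  rcases i with c | c
  · simp only [Sum.elim_inl]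
    rw [dif_pos (show c ∈ t from hi)]
  · rfl

theorem acl_subset_acl {A B : Set M} (h : A ⊆ acl L B) : acl L A ⊆ acl L B :=
  (acl_mono h).trans (acl_acl B).subset

theorem acl_image (σ : M ≃[L] M) (A : Set M) : acl L (σ '' A) = σ '' acl L A := by
  have key : ∀ (σ : M ≃[L] M) (A : Set M), σ '' acl L A ⊆ acl L (σ '' A) := by
    rintro σ A _ ⟨a, ⟨s, hs, hfin, ha⟩, rfl⟩
    refine ⟨σ '' s, ?_, hfin.image σ, mem_image_of_mem σ ha⟩
    obtain ⟨φ, hφ⟩ := Set.definable_iff_exists_formula_sum.1 hs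
    refine Set.definable_iff_exists_formula_sum.2
      ⟨φ.relabel (Sum.map (fun a : A => ⟨σ a, mem_image_of_mem σ a.2⟩) id), ?_⟩
    ext x
    have h1 : (fun k => σ.symm (x k)) ∈ {x : Fin 1 → M | x 0 ∈ s} ↔ x 0 ∈ σ '' s := by
      constructor
      · intro h
        exact ⟨_, h, by simp⟩
      · rintro ⟨y, hy, hxy⟩
        simp only [mem_ofPred_eq, ← hxy]
        simpa using hy
    rw [mem_ofPred_eq, ← h1, hφ]
    simp only [mem_ofPred_eq, Language.Formula.realize_relabel]
    rw [← Language.StrongHomClass.realize_formula σ]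
    congr! 1
    funext p
    rcases p with p | p <;> simp
  refine Subset.antisymm ?_ (key σ A)
  have := image_mono (f := σ) (key σ.symm (σ '' A))
  simpa [image_image] using this

theorem mem_acl_image {σ : M ≃[L] M} {A : Set M} {a : M} :
    σ a ∈ acl L (σ '' A) ↔ a ∈ acl L A := by
  rw [acl_image]
  exact σ.injective.mem_set_image

/-- Automorphisms preserve sets that are definable without parameters. -/
theorem Definable.comp_mem_iff {ι : Type*} {E : Set (ι → M)} (hE : (∅ : Set M).Definable L E)
    (σ : M ≃[L] M) (v : ι → M) : σ ∘ v ∈ E ↔ v ∈ E := by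
  obtain ⟨φ, rfl⟩ := Set.empty_definable_iff.1 hE
  exact Language.StrongHomClass.realize_formula σ φ

/-! ### Saturation and type-definable sets in small tuples of variables -/

variable {κ : Cardinal.{w}}

theorem IsSaturated.sInter_nonempty (h : IsSaturated L κ M) {A : Set M} (hA : Cardinal.mk A < κ)
    {𝒮 : Set (Set M)} (hd : ∀ S ∈ 𝒮, A.Definable₁ L S)
    (hfin : ∀ T ⊆ 𝒮, T.Finite → (⋂₀ T).Nonempty) : (⋂₀ 𝒮).Nonempty := by
  obtain ⟨a, ha⟩ := h A hA {φ | {x : M | φ.Realize fun _ => x} ∈ 𝒮} fun p₀ hp₀ => by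
    obtain ⟨a, ha⟩ := hfin ((fun φ : L[[A]].Formula Unit => {x : M | φ.Realize fun _ => x}) '' p₀)
      (by rintro _ ⟨φ, hφ, rfl⟩; exact hp₀ hφ) (p₀.finite_toSet.image _)
    exact ⟨a, fun φ hφ => mem_sInter.1 ha _ (mem_image_of_mem _ hφ)⟩
  refine ⟨a, fun S hS => ?_⟩
  obtain ⟨φ, hφ⟩ := (definable₁_iff (β := Unit)).1 (hd S hS)
  have hSφ : S = {x : M | φ.Realize fun _ => x} := by
    ext x
    have := congrArg (fun S : Set (Unit → M) => (fun _ => x) ∈ S) hφ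
    simpa using this
  have := ha φ (show _ ∈ 𝒮 by rwa [← hSφ])
  rw [hSφ]
  exact this

/-- Saturation for small tuples of variables. -/
theorem IsSaturated.sInter_nonempty_pi (h : IsSaturated L κ M) (hκ' : Cardinal.aleph0 ≤ κ)
    {A : Set M} (hA : Cardinal.mk A < κ) {ι : Type w} (hι : Cardinal.mk ι < κ)
    {𝒟 : Set (Set (ι → M))} (hd : ∀ D ∈ 𝒟, A.Definable L D)
    (hfin : ∀ T ⊆ 𝒟, T.Finite → (⋂₀ T).Nonempty) : (⋂₀ 𝒟).Nonempty := by
  classical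
  -- Zorn's lemma is applied to partial assignments finitely consistent with `𝒟`; a maximal one is
  -- shown to be total.
  let Good : Set (Set (ι × M)) := {G | ∀ T ⊆ 𝒟, T.Finite → ∀ G₀ ⊆ G, G₀.Finite →
    ∃ v ∈ ⋂₀ T, ∀ p ∈ G₀, v p.1 = p.2}
  obtain ⟨G, hG⟩ : ∃ G, Maximal (· ∈ Good) G := by
    refine zorn_subset Good fun c hc hchain => ?_
    rcases c.eq_empty_or_nonempty with rfl | hne
    · refine ⟨∅, fun T hT hTf G₀ hG₀ _ => ?_, by simp⟩
      obtain ⟨v, hv⟩ := hfin T hT hTf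
      exact ⟨v, hv, fun p hp => (hG₀ hp).elim⟩
    · refine ⟨⋃₀ c, fun T hT hTf G₀ hG₀ hG₀f => ?_, fun s hs => subset_sUnion_of_mem hs⟩
      obtain ⟨G, hGc, hG⟩ := hchain.directedOn.exists_mem_subset_of_finite_of_subset_sUnion
        hne hG₀f hG₀
      exact hc hGc T hT hTf G₀ hG hG₀f
  have hfun : ∀ p ∈ G, ∀ q ∈ G, p.1 = q.1 → p = q := by
    intro p hp q hq hpq
    obtain ⟨v, -, hv⟩ := hG.prop ∅ (empty_subset _) finite_empty {p, q}
      (by rintro x (rfl | rfl) <;> assumption) (by simp)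
    have h1 := hv p (by simp)
    have h2 := hv q (by simp)
    exact Prod.ext hpq (by rw [← h1, ← h2, hpq])
  have hGcard : Cardinal.mk (Prod.snd '' G : Set M) < κ := by
    refine Cardinal.mk_image_le.trans_lt (lt_of_le_of_lt ?_ hι)
    exact Cardinal.mk_le_of_injective (f := fun p : G => p.1.1) fun p q hpq =>
      Subtype.ext (hfun p p.2 q q.2 hpq)
  have hAG : Cardinal.mk (A ∪ Prod.snd '' G : Set M) < κ :=
    (Cardinal.mk_union_le _ _).trans_lt (Cardinal.add_lt_of_lt hκ' hA hGcard)
  have htot : ∀ i, ∃ m, (i, m) ∈ G := by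
    intro i
    -- The possible values at `i` under a finite part of `𝒟` and of `G`. One-variable saturation
    -- finds a value good for all such parts, and maximality puts it in `G`.
    let F : Set (Set (ι → M)) × Set (ι × M) → Set M := fun q =>
      (fun v : ι → M => v i) '' (⋂₀ q.1 ∩ ⋂ p : q.2, {v | v p.1.1 = p.1.2})
    obtain ⟨m, hm⟩ := h.sInter_nonempty hAG
      (𝒮 := F '' {q | q.1 ⊆ 𝒟 ∧ q.1.Finite ∧ q.2 ⊆ G ∧ q.2.Finite}) (by
        rintro _ ⟨⟨T, G₀⟩, ⟨hT, hTf, hG₀, hG₀f⟩, rfl⟩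
        have := hTf.to_subtype
        have := hG₀f.to_subtype
        refine Definable.eval_image (Set.Definable.inter ?_ ?_) i
        · rw [sInter_eq_iInter]
          exact definable_iInter_of_finite fun D => (hd _ (hT D.2)).mono subset_union_left
        · exact definable_iInter_of_finite fun p =>
            definable_eval_eq (mem_union_right A (mem_image_of_mem Prod.snd (hG₀ p.2))) _) (by
        intro 𝒯 h𝒯 h𝒯f
        choose! q hq hqF using fun S (hS : S ∈ 𝒯) => h𝒯 hS
        obtain ⟨v, hvT, hvG⟩ := hG.prop (⋃ S ∈ 𝒯, (q S).1) (iUnion₂_subset fun S hS => (hq S hS).1)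
          (h𝒯f.biUnion fun S hS => (hq S hS).2.1) (⋃ S ∈ 𝒯, (q S).2)
          (iUnion₂_subset fun S hS => (hq S hS).2.2.1) (h𝒯f.biUnion fun S hS => (hq S hS).2.2.2)
        refine ⟨v i, fun S hS => ?_⟩
        rw [← hqF S hS]
        exact ⟨v, ⟨fun D hD => hvT D (mem_biUnion hS hD),
          mem_iInter.2 fun p => hvG p (mem_biUnion hS p.2)⟩, rfl⟩)
    have hmax : insert (i, m) G ∈ Good := by
      intro T hT hTf G₀ hG₀ hG₀f
      obtain ⟨v, ⟨hvT, hvG⟩, hvi⟩ := mem_sInter.1 hm _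
        (mem_image_of_mem F (show (T, G₀ ∩ G) ∈ _ from ⟨hT, hTf, inter_subset_right,
          hG₀f.subset inter_subset_left⟩))
      refine ⟨v, hvT, fun p hp => ?_⟩
      rcases hG₀ hp with rfl | hpG
      · exact hvi
      · exact mem_iInter.1 hvG ⟨p, hp, hpG⟩
    exact ⟨m, hG.le_of_ge hmax (subset_insert _ _) (mem_insert _ _)⟩
  choose v hv using htot
  refine ⟨v, fun D hD => ?_⟩
  obtain ⟨s, hs⟩ := Definable.exists_finset_congr (hd D hD)
  obtain ⟨v', hv'D, hv'⟩ := hG.prop {D} (singleton_subset_iff.2 hD) (finite_singleton D)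
    ((fun i => (i, v i)) '' s) (by rintro _ ⟨i, -, rfl⟩; exact hv i) (s.finite_toSet.image _)
  exact hs v' v (fun i hi => hv' _ (mem_image_of_mem _ hi)) (by simpa using hv'D)

/-- A set of tuples is type-definable over `A` if it is an intersection of sets definable
over `A`. -/
def IsTypeDefinable (L : FirstOrder.Language.{u, v}) {M : Type w} [L.Structure M] (A : Set M)
    {ι : Type*} (P : Set (ι → M)) : Prop :=
  ∃ 𝒟 : Set (Set (ι → M)), (∀ D ∈ 𝒟, A.Definable L D) ∧ P = ⋂₀ 𝒟

theorem IsTypeDefinable.of_definable {A : Set M} {ι : Type*} {P : Set (ι → M)}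
    (h : A.Definable L P) : IsTypeDefinable L A P :=
  ⟨{P}, by simpa using h, by simp⟩

theorem IsTypeDefinable.mono {A B : Set M} {ι : Type*} {P : Set (ι → M)}
    (h : IsTypeDefinable L A P) (hAB : A ⊆ B) : IsTypeDefinable L B P := by
  obtain ⟨𝒟, h𝒟, rfl⟩ := h
  exact ⟨𝒟, fun D hD => (h𝒟 D hD).mono hAB, rfl⟩

theorem IsTypeDefinable.iInter {A : Set M} {ι J : Type*} {P : J → Set (ι → M)}
    (h : ∀ j, IsTypeDefinable L A (P j)) : IsTypeDefinable L A (⋂ j, P j) := by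
  choose 𝒟 h𝒟 hP using h
  refine ⟨⋃ j, 𝒟 j, fun D hD => ?_, ?_⟩
  · obtain ⟨j, hj⟩ := mem_iUnion.1 hD
    exact h𝒟 j D hj
  · rw [sInter_iUnion]
    exact iInter_congr hP

theorem IsTypeDefinable.inter {A : Set M} {ι : Type*} {P Q : Set (ι → M)}
    (hP : IsTypeDefinable L A P) (hQ : IsTypeDefinable L A Q) : IsTypeDefinable L A (P ∩ Q) := by
  rw [inter_eq_iInter]
  exact .iInter fun b => by cases b <;> assumption

/-- A relation with uniformly bounded fibres that witnesses algebraicity for one tuple witnesses it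
for every tuple satisfying it. Algebraicity is thus a union of definable conditions, so
non-algebraicity survives compactness. -/
theorem isTypeDefinable_notMem_acl (A : Set M) {ι : Type*} (K : Set ι) (i : ι) :
    IsTypeDefinable L A {v : ι → M | v i ∉ acl L (A ∪ v '' K)} := by
  refine ⟨{D | A.Definable L D ∧ {v : ι → M | v i ∉ acl L (A ∪ v '' K)} ⊆ D},
    fun D hD => hD.1, Subset.antisymm (fun v hv D hD => hD.2 hv) fun v hv hmem => ?_⟩
  have hmem' : v i ∈ acl L (A ∪ range fun k : K => v k) := by
    rwa [show (range fun k : K => v k) = v '' K from (image_eq_range v K).symm]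
  obtain ⟨E, n, hE, hn, hvE⟩ := mem_acl_union_range.1 hmem'
  have hcomp : ∀ x : ι → M, x ∘ Sum.elim (fun k : K => (k : ι)) (fun _ : Unit => i) =
      Sum.elim (fun k : K => x k) (fun _ => x i) := by
    intro x
    funext p
    rcases p with p | p <;> rfl
  have := mem_sInter.1 hv
    ((fun x : ι → M => x ∘ Sum.elim (fun k : K => (k : ι)) (fun _ : Unit => i)) ⁻¹' E)ᶜ
    ⟨(hE.preimage_comp _).compl, fun x hx hxE => hx ?_⟩
  · exact this (by rw [mem_preimage, hcomp]; exact hvE)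
  · rw [mem_preimage, hcomp] at hxE
    rw [image_eq_range]
    exact mem_acl_union_range.2 ⟨E, n, hE, hn, hxE⟩

theorem IsSaturated.iInter_nonempty_pi (h : IsSaturated L κ M) (hκ' : Cardinal.aleph0 ≤ κ)
    {A : Set M} (hA : Cardinal.mk A < κ) {ι : Type w} (hι : Cardinal.mk ι < κ) {J : Type*}
    {P : J → Set (ι → M)} (hd : ∀ j, IsTypeDefinable L A (P j))
    (hfin : ∀ s : Finset J, ∃ v, ∀ j ∈ s, v ∈ P j) : (⋂ j, P j).Nonempty := by
  classical
  choose 𝒟 h𝒟 hP using hd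
  have := h.sInter_nonempty_pi hκ' hA hι (𝒟 := ⋃ j, 𝒟 j) (fun D hD => by
    obtain ⟨j, hj⟩ := mem_iUnion.1 hD
    exact h𝒟 j D hj) (fun T hT hTf => by
    choose j hj using fun D : T => mem_iUnion.1 (hT D.2)
    have := hTf.to_subtype
    have := Fintype.ofFinite T
    obtain ⟨v, hv⟩ := hfin (Finset.univ.image j)
    refine ⟨v, fun D hD => ?_⟩
    have := hv (j ⟨D, hD⟩) (Finset.mem_image_of_mem _ (Finset.mem_univ _))
    rw [hP] at this
    exact this D (hj ⟨D, hD⟩))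
  rwa [sInter_iUnion, ← iInter_congr hP] at this

/-! ### Conjugation by automorphisms -/

/-- A tuple may repeat entries, so `c` is re-indexed by its range through a section `g`. Equalities
between coordinates pass from `c` to `c'`, so the choice of section is immaterial. -/
theorem IsStronglyHomogeneous.exists_equiv (h : IsStronglyHomogeneous L κ M) {ι : Type w}
    (hι : Cardinal.mk ι < κ) {c c' : ι → M}
    (hc : ∀ D : Set (ι → M), (∅ : Set M).Definable L D → c ∈ D → c' ∈ D) :
    ∃ σ : M ≃[L] M, ∀ i, σ (c i) = c' i := by
  choose g hg using fun a : range c => a.2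
  have hg' : c ∘ g = (fun a : range c => (a : M)) := funext hg
  have key : ∀ φ : L.Formula (range c), φ.Realize (fun a : range c => (a : M)) →
      φ.Realize (c' ∘ g) := by
    intro φ hφ
    have := hc {v | (φ.relabel g).Realize v} (Set.empty_definable_iff.2 ⟨_, rfl⟩)
      (by rw [mem_ofPred_eq, Language.Formula.realize_relabel, hg']; exact hφ)
    rwa [mem_ofPred_eq, Language.Formula.realize_relabel] at this
  obtain ⟨σ, hσ⟩ := h (range c) (Cardinal.mk_range_le.trans_lt hι) (c' ∘ g) fun φ =>
    ⟨key φ, fun hφ => by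
      by_contra hn
      exact (key φ.not hn) hφ⟩
  refine ⟨σ, fun i => ?_⟩
  rw [hσ ⟨c i, mem_range_self i⟩]
  exact hc {v | v (g ⟨c i, mem_range_self i⟩) = v i} (definable_eq _ _ _) (hg _)

theorem IsStronglyHomogeneous.exists_equiv_over (h : IsStronglyHomogeneous L κ M)
    (hκ' : Cardinal.aleph0 ≤ κ) {ι : Type w}
    (hι : Cardinal.mk ι < κ) {A : Set M} (hA : Cardinal.mk A < κ) {c c' : ι → M}
    (hc : ∀ D : Set (ι → M), A.Definable L D → c ∈ D → c' ∈ D) :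
    ∃ σ : M ≃[L] M, (∀ a ∈ A, σ a = a) ∧ ∀ i, σ (c i) = c' i := by
  obtain ⟨σ, hσ⟩ := h.exists_equiv (ι := A ⊕ ι)
    (by rw [Cardinal.mk_sum, Cardinal.lift_id, Cardinal.lift_id]
        exact Cardinal.add_lt_of_lt hκ' hA hι)
    (c := Sum.elim (↑) c) (c' := Sum.elim (↑) c') fun D hD hcD => by
      have := Definable.curry (fun a : A => (a : M)) hD
      rw [empty_union, Subtype.range_coe] at this
      exact hc _ this hcD
  exact ⟨σ, fun a ha => hσ (Sum.inl ⟨a, ha⟩), fun i => hσ (Sum.inr i)⟩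

/-- A non-algebraic element can be moved away from the algebraic closure of any small set. -/
theorem IsBigModel.exists_equiv_notMem_acl (hM : IsBigModel L κ M) {A B : Set M}
    (hA : Cardinal.mk A < κ) (hB : Cardinal.mk B < κ) {a : M} (ha : a ∉ acl L A) :
    ∃ σ : M ≃[L] M, (∀ x ∈ A, σ x = x) ∧ σ a ∉ acl L (A ∪ B) := by
  have hAB : Cardinal.mk (A ∪ B : Set M) < κ :=
    (Cardinal.mk_union_le _ _).trans_lt (Cardinal.add_lt_of_lt hM.aleph0_lt.le hA hB)
  -- The type of `a` over `A` is consistent with avoiding every finite `A ∪ B`-definable set: a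
  -- finite part of it defines an infinite set, since `a` is not algebraic over `A`.
  obtain ⟨b, hb⟩ := hM.saturated.sInter_nonempty hAB
    (𝒮 := {S | (A.Definable₁ L S ∧ a ∈ S) ∨ ((A ∪ B).Definable₁ L S ∧ Sᶜ.Finite)})
    (by
      rintro S (⟨hS, -⟩ | ⟨hS, -⟩)
      · exact hS.mono subset_union_left
      · exact hS)
    (by
      intro T hT hTf
      have h1 : A.Definable₁ L (⋂₀ {S ∈ T | A.Definable₁ L S ∧ a ∈ S}) := by
        have := (hTf.subset (sep_subset T fun S => A.Definable₁ L S ∧ a ∈ S)).to_subtype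
        have h := definable_iInter_of_finite (A := A) (L := L)
          (f := fun S : ↥{S ∈ T | A.Definable₁ L S ∧ a ∈ S} => {x : Fin 1 → M | x 0 ∈ S.1})
          fun S => S.2.2.1
        rw [sInter_eq_iInter, Definable₁]
        convert h using 1
        ext x
        simp
      have h2 : (⋂₀ {S ∈ T | A.Definable₁ L S ∧ a ∈ S}).Infinite := fun hf =>
        ha ⟨_, h1, hf, fun S hS => hS.2.2⟩
      have h3 : (⋃ S ∈ {S ∈ T | Sᶜ.Finite}, Sᶜ).Finite :=
        (hTf.subset (sep_subset _ _)).biUnion fun S hS => hS.2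
      obtain ⟨b, hb1, hb2⟩ := (h2.sdiff h3).nonempty
      refine ⟨b, fun S hS => ?_⟩
      rcases hT hS with h | h
      · exact hb1 S ⟨hS, h⟩
      · by_contra hbS
        exact hb2 (mem_biUnion (show S ∈ {S ∈ T | Sᶜ.Finite} from ⟨hS, h.2⟩) hbS))
  obtain ⟨σ, hσ, hσa⟩ := hM.homogeneous.exists_equiv_over hM.aleph0_lt.le (ι := PUnit)
    (by simpa using hM.aleph0_lt.trans_le' Cardinal.one_lt_aleph0.le) hA
    (c := fun _ => a) (c' := fun _ => b) fun D hD haD => by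
      have h1 := Definable.eval_image hD PUnit.unit
      have := mem_sInter.1 hb _ (Or.inl ⟨h1, _, haD, rfl⟩)
      obtain ⟨v, hv, hvb⟩ := this
      convert hv using 1
      funext i
      exact hvb.symm
  refine ⟨σ, hσ, ?_⟩
  rw [hσa PUnit.unit]
  rintro ⟨S, hS, hSf, hbS⟩
  exact mem_sInter.1 hb Sᶜ (Or.inr ⟨hS.compl, by rwa [compl_compl]⟩) hbS


/-! ### Cardinality of algebraic closures -/

/-- An algebraic element is coded by a formula isolating a finite set and by its number in a fixed
enumeration of that set. -/
theorem mk_acl_le {ν : Cardinal.{w}}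
    (hν : Cardinal.lift.{max u v} ν = Cardinal.lift.{w} L.card) (A : Set M) :
    Cardinal.mk (acl L A) ≤ max Cardinal.aleph0 (Cardinal.mk A + 1 + ν) := by
  classical
  have h1 : ∀ a : acl L A, ∃ φ : L.Formula (A ⊕ Fin 1),
      {x : M | φ.Realize (Sum.elim (↑) fun _ => x)}.Finite ∧
      φ.Realize (Sum.elim (↑) fun _ => (a : M)) := by
    rintro ⟨a, s, hs, hfin, ha⟩
    obtain ⟨φ, hφ⟩ := Set.definable_iff_exists_formula_sum.1 hs
    have hsφ : s = {x : M | φ.Realize (Sum.elim (↑) fun _ => x)} := by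
      ext x
      have := congrArg (fun S : Set (Fin 1 → M) => (fun _ => x) ∈ S) hφ
      simpa using this
    refine ⟨φ, hsφ ▸ hfin, ?_⟩
    rw [hsφ] at ha
    exact ha
  choose φ hφ hφa using h1
  have h2 : ∀ ψ : L.Formula (A ⊕ Fin 1), ∃ e : M → ℕ,
      {x : M | ψ.Realize (Sum.elim (↑) fun _ => x)}.Finite →
        InjOn e {x : M | ψ.Realize (Sum.elim (↑) fun _ => x)} := by
    intro ψ
    by_cases h : {x : M | ψ.Realize (Sum.elim ((↑) : A → M) fun _ => x)}.Finite
    · obtain ⟨e, he⟩ := Set.countable_iff_exists_injOn.1 h.countable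
      exact ⟨e, fun _ => he⟩
    · exact ⟨fun _ => 0, fun h' => (h h').elim⟩
  choose e he using h2
  let F : acl L A → (Σ n, L.BoundedFormula (A ⊕ Fin 1) n) × ℕ := fun a => (⟨0, φ a⟩, e (φ a) a)
  have hF : Function.Injective F := by
    intro a b hab
    have hab1 : φ a = φ b := by
      have := (Prod.ext_iff.1 hab).1
      simpa [F] using this
    have hab2 : e (φ a) a = e (φ b) b := (Prod.ext_iff.1 hab).2
    refine Subtype.ext (he (φ a) (hφ a) (hφa a) ?_ ?_)
    · have := hφa b
      rw [← hab1] at this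
      exact this
    · rw [hab2, hab1]
  have h3 : Cardinal.lift.{max u v} (Cardinal.mk (acl L A)) ≤
      Cardinal.mk (Σ n, L.BoundedFormula (A ⊕ Fin 1) n) * Cardinal.aleph0 := by
    have := Cardinal.mk_le_of_injective
      (hF.comp (ULift.down_injective : Function.Injective (ULift.down.{max u v, w})))
    rw [Cardinal.mk_uLift, Cardinal.mk_prod] at this
    simpa using this
  have h4 := Language.BoundedFormula.card_le (L := L) (α := A ⊕ Fin 1)
  have h5 : Cardinal.lift.{max u v} (Cardinal.mk (↥A ⊕ Fin 1)) + Cardinal.lift.{w} L.card =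
      Cardinal.lift.{max u v} (Cardinal.mk A + 1 + ν) := by
    simp [hν]
  rw [h5] at h4
  rw [← Cardinal.lift_le.{max u v}, Cardinal.lift_max, Cardinal.lift_aleph0]
  exact h3.trans (Cardinal.mul_le_of_le (le_max_left _ _) h4 (le_max_left _ _))

theorem IsBigModel.exists_mk_acl_le (hM : IsBigModel L κ M) :
    ∃ ν : Cardinal.{w}, Cardinal.aleph0 ≤ ν ∧ ν < κ ∧
      ∀ A : Set M, Cardinal.mk (acl L A) ≤ max ν (Cardinal.mk A) := by
  obtain ⟨ν, hν⟩ := Cardinal.mem_range_lift_of_le (hM.card_lt.le)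
  have hνκ : ν < κ := by
    have := hM.card_lt
    rwa [← hν, Cardinal.lift_lt] at this
  refine ⟨max Cardinal.aleph0 ν, le_max_left _ _, max_lt hM.aleph0_lt hνκ, fun A => ?_⟩
  refine (mk_acl_le hν A).trans (max_le ((le_max_left _ _).trans (le_max_left _ _)) ?_)
  have h0 : Cardinal.aleph0 ≤ max (max Cardinal.aleph0 ν) (Cardinal.mk A) :=
    (le_max_left _ _).trans (le_max_left _ _)
  exact Cardinal.add_le_of_le h0 (Cardinal.add_le_of_le h0 (le_max_right _ _)
    (Cardinal.one_lt_aleph0.le.trans h0)) ((le_max_right _ _).trans (le_max_left _ _))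

theorem IsBigModel.mk_acl_lt (hM : IsBigModel L κ M) {A : Set M} (hA : Cardinal.mk A < κ) :
    Cardinal.mk (acl L A) < κ := by
  obtain ⟨ν, -, hν, h⟩ := hM.exists_mk_acl_le
  exact (h A).trans_lt (max_lt hν hA)

theorem IsBigModel.mk_union_lt (hM : IsBigModel L κ M) {A B : Set M} (hA : Cardinal.mk A < κ)
    (hB : Cardinal.mk B < κ) : Cardinal.mk (A ∪ B : Set M) < κ :=
  (Cardinal.mk_union_le _ _).trans_lt (Cardinal.add_lt_of_lt hM.aleph0_lt.le hA hB)


/-! ### Axioms that M-dividing independence always satisfies -/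

theorem mIndep_iff {A C B : Set M} : MIndep L A C B ↔ ∀ C' : Set M, C ⊆ C' → C' ⊆ acl L (B ∪ C) →
    ∀ x, x ∈ acl L (A ∪ C') → x ∈ acl L (B ∪ C') → x ∈ acl L C' :=
  forall_congr' fun _ => forall_congr' fun _ => forall_congr' fun _ =>
    ⟨fun h _ h1 h2 => h ▸ ⟨h1, h2⟩, fun h => Subset.antisymm (fun x hx => h x hx.1 hx.2)
      (subset_inter (acl_mono subset_union_right) (acl_mono subset_union_right))⟩

theorem MIndep.image {A B C : Set M} (σ : M ≃[L] M) (h : MIndep L A C B) :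
    MIndep L (σ '' A) (σ '' C) (σ '' B) := by
  intro C' hC hC'
  have h1 : C' = σ '' (σ.symm '' C') := by simp [image_image]
  rw [h1, ← image_union, ← image_union, acl_image, acl_image, acl_image,
    ← image_inter σ.injective, h]
  · intro c hc
    exact ⟨σ c, hC (mem_image_of_mem σ hc), by simp⟩
  · rintro _ ⟨x, hx, rfl⟩
    have := hC' hx
    rw [← image_union, acl_image] at this
    obtain ⟨y, hy, rfl⟩ := this
    simpa using hy

theorem MIndep.mono {A B C A' B' : Set M} (hA : A' ⊆ A) (hB : B' ⊆ B) (h : MIndep L A C B) :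
    MIndep L A' C B' := by
  rw [mIndep_iff] at h ⊢
  exact fun C' hC hC' x hx1 hx2 =>
    h C' hC (hC'.trans (acl_mono (union_subset_union_left C hB))) x
      (acl_mono (union_subset_union_left C' hA) hx1) (acl_mono (union_subset_union_left C' hB) hx2)

theorem MIndep.base_mono {A B C D : Set M} (hD : D ⊆ C) (hC : C ⊆ acl L (B ∪ D))
    (h : MIndep L A D B) : MIndep L A C B := fun C' hCC' hC' =>
  h C' (hD.trans hCC') (hC'.trans (acl_subset_acl (union_subset
    (subset_union_left.trans (subset_acl _)) hC)))

/-- An element algebraic over both `B ∪ D'` and `A ∪ D'` is algebraic over `C ∪ D'` by the first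
hypothesis, hence over `D'` by the second. The inclusion `C ⊆ B` is not demanded, which extension
will exploit. -/
theorem MIndep.trans {A B C D : Set M} (hD : D ⊆ C) (h₁ : MIndep L B C A)
    (h₂ : MIndep L C D A) : MIndep L B D A := by
  rw [mIndep_iff] at h₁ h₂ ⊢
  intro D' hDD' hD' x hxB hxA
  refine h₂ D' hDD' hD' x ?_ hxA
  refine h₁ (C ∪ D') subset_union_left (union_subset ?_ ?_) x ?_ ?_
  · exact subset_union_right.trans (subset_acl _)
  · exact hD'.trans (acl_mono (union_subset_union_right A hD))
  · exact acl_mono (union_subset_union_right B subset_union_right) hxB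
  · exact acl_mono (union_subset_union_right A subset_union_right) hxA

theorem MIndep.normal {A B C : Set M} (h : MIndep L A C B) : MIndep L (A ∪ C) C B := by
  intro C' hC hC'
  rw [union_assoc, union_eq_self_of_subset_left hC]
  exact h C' hC hC'

theorem mIndep_of_finite {A B C : Set M} (h : ∀ A₀ ⊆ A, A₀.Finite → MIndep L A₀ C B) :
    MIndep L A C B := by
  rw [mIndep_iff]
  intro C' hC hC' x hxA hxB
  obtain ⟨F, hF, hFf, hx⟩ := exists_finite_of_mem_acl hxA
  refine mIndep_iff.1 (h (F ∩ A) inter_subset_right (hFf.subset inter_subset_left)) C' hC hC' x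
    (acl_mono (fun y hy => ?_) hx) hxB
  exact (hF hy).imp (fun h => ⟨hy, h⟩) id

theorem MIndep.mem_acl {a : M} {B : Set M} (h : MIndep L {a} B {a}) : a ∈ acl L B :=
  mIndep_iff.1 h B Subset.rfl (subset_union_right.trans (subset_acl _)) a
    (subset_acl _ (Or.inl rfl)) (subset_acl _ (Or.inl rfl))

/-! ### Symmetry of arbitrary independence relations -/

variable {I : Set M → Set M → Set M → Prop}

theorem mk_image_equiv (σ : M ≃[L] M) (A : Set M) : Cardinal.mk (σ '' A) = Cardinal.mk A :=
  Cardinal.mk_image_eq σ.injective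

theorem image_eq_self {σ : M ≃[L] M} {A : Set M} (h : ∀ x ∈ A, σ x = x) : σ '' A = A := by
  rw [image_congr h, image_id']

theorem symm_apply_eq_self {σ : M ≃[L] M} {x : M} (h : σ x = x) : σ.symm x = x := by
  conv_lhs => rw [← h]
  simp

theorem exists_forall_lt_of_mk_lt {c : Cardinal.{w}} (hc : c.IsRegular) {α : Type w}
    (hα : Cardinal.mk α < c) (g : α → c.ord.ToType) : ∃ i, ∀ a, g a < i := by
  by_contra! h
  have hcof : IsCofinal (range g) := fun i => by
    obtain ⟨a, ha⟩ := h i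
    exact ⟨g a, mem_range_self a, ha⟩
  have h1 := Order.cof_le hcof
  rw [Ordinal.cof_toType, hc.cof_ord] at h1
  exact (h1.trans Cardinal.mk_range_le).not_gt hα

/-- Extension on the right-hand side, obtained from extension by conjugation. -/
theorem IsIndependenceRelation.exists_right (hI : IsIndependenceRelation L κ I) {X B C D : Set M}
    (hκ : Cardinal.aleph0 ≤ κ) (hX : Cardinal.mk X < κ) (hB : Cardinal.mk B < κ)
    (hC : Cardinal.mk C < κ) (hD : Cardinal.mk D < κ) (h : I X C B) :
    ∃ σ : M ≃[L] M, (∀ x ∈ B ∪ C, σ x = x) ∧ I X C (σ '' D ∪ B ∪ C) := by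
  have hU : ∀ {A B : Set M}, Cardinal.mk A < κ → Cardinal.mk B < κ →
    Cardinal.mk (A ∪ B : Set M) < κ := fun hA hB =>
    (Cardinal.mk_union_le _ _).trans_lt (Cardinal.add_lt_of_lt hκ hA hB)
  obtain ⟨σ, hσ, hI'⟩ := hI.extension X B C (D ∪ B ∪ C) hX (hU (hU hD hB) hC) hC
    (subset_union_right.trans subset_union_left) h
  have hσ' : ∀ x ∈ B ∪ C, σ.symm x = x := fun x hx => symm_apply_eq_self (hσ x hx)
  refine ⟨σ.symm, hσ', ?_⟩
  have := hI.invariance _ _ _ (by rwa [mk_image_equiv]) (hU (hU hD hB) hC) hC σ.symm hI'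
  rw [image_union, image_union, image_eq_self fun x hx => hσ' x (Or.inl hx),
    image_eq_self fun x hx => hσ' x (Or.inr hx), image_image] at this
  simpa using this

theorem IsIndependenceRelation.symm (hI : IsIndependenceRelation L κ I)
    (hκ : κ.IsStrongLimit) (hκ' : Cardinal.aleph0 < κ) {A B C : Set M}
    (hA : Cardinal.mk A < κ) (hB : Cardinal.mk B < κ) (hC : Cardinal.mk C < κ)
    (h : I A C B) : I B C A := by
  classical
  have hU : ∀ {A B : Set M}, Cardinal.mk A < κ → Cardinal.mk B < κ →
    Cardinal.mk (A ∪ B : Set M) < κ := fun hA hB =>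
    (Cardinal.mk_union_le _ _).trans_lt (Cardinal.add_lt_of_lt hκ'.le hA hB)
  obtain ⟨μ, hμκ, hμ⟩ := hI.local_character B hB
  let ν : Cardinal.{w} := max μ Cardinal.aleph0
  -- A successor is regular, so a set of size below `μ` cannot be cofinal in the sequence; it stays
  -- below `κ` because `κ` is a limit.
  let lam : Cardinal.{w} := Order.succ ν
  have hν : Cardinal.aleph0 ≤ ν := le_max_right _ _
  have hlam : lam.IsRegular := Cardinal.isRegular_succ hν
  have hlamκ : lam < κ := hκ.isSuccLimit.succ_lt (max_lt hμκ hκ')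
  let J := lam.ord.ToType
  have hJ : Cardinal.mk J = lam := by simp [J]
  have hJκ : Cardinal.mk J < κ := hJ ▸ hlamκ
  have hW : ∀ (T : Set J) (σ : J → (M ≃[L] M)),
      Cardinal.mk (⋃ j ∈ T, σ j '' A : Set M) < κ := by
    intro T σ
    have : (⋃ j ∈ T, σ j '' A : Set M) ⊆ range fun p : J × A => σ p.1 p.2 := by
      intro x hx
      obtain ⟨j, -, a, ha, rfl⟩ := mem_iUnion₂.1 hx
      exact ⟨(j, ⟨a, ha⟩), rfl⟩
    refine ((Cardinal.mk_le_mk_of_subset this).trans Cardinal.mk_range_le).trans_lt ?_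
    rw [Cardinal.mk_prod, Cardinal.lift_id, Cardinal.lift_id]
    exact Cardinal.mul_lt_of_lt hκ'.le hJκ hA
  -- The recursive choice of the conjugates of `A`.
  let P : J → (J → (M ≃[L] M)) → (M ≃[L] M) → Prop := fun i f σ =>
    (∀ x ∈ B ∪ C, σ x = x) ∧ I (⋃ j ∈ Iio i, f j '' A) C (σ '' A ∪ B ∪ C)
  obtain ⟨σ, hσ⟩ : ∃ σ : J → (M ≃[L] M), ∀ i, I (⋃ j ∈ Iio i, σ j '' A) C B → P i σ (σ i) := by
    -- The value at `i` has property `P` only if the earlier conjugates are independent from `B`,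
    -- which is established afterwards by induction. The default value at indices not below `i` is
    -- invisible to `P i`.
    let step : ∀ i : J, (∀ j : J, j < i → (M ≃[L] M)) → (M ≃[L] M) := fun i f =>
      Classical.epsilon (P i fun j => if h : j < i then f j h else Language.Equiv.refl L M)
    let σ : J → (M ≃[L] M) := (wellFounded_lt (α := J)).fix step
    refine ⟨σ, fun i hi => ?_⟩
    have hσi : σ i = step i fun j _ => σ j := (wellFounded_lt (α := J)).fix_eq step i
    have hcongr : ∀ f : J → (M ≃[L] M), (∀ j < i, f j = σ j) → P i f = P i σ := by
      intro f hf
      have : (⋃ j ∈ Iio i, f j '' A : Set M) = ⋃ j ∈ Iio i, σ j '' A :=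
        iUnion₂_congr fun j hj => by rw [hf j hj]
      simp only [P, this]
    have hP := hcongr (fun j => if h : j < i then σ j else Language.Equiv.refl L M)
      fun j hj => dif_pos hj
    rw [hσi]
    simp only [step, hP]
    exact Classical.epsilon_spec (hI.exists_right hκ'.le (hW _ _) hB hC hA hi)
  -- Adding the conjugate at `i`: base monotonicity moves it into the base, and transitivity
  -- combines the result with its own independence from `B`.
  have hle : ∀ i, I (⋃ j ∈ Iio i, σ j '' A) C B → I (⋃ j ∈ Iic i, σ j '' A) C B := by
    intro i hi
    obtain ⟨hfix, hind⟩ := hσ i hi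
    have hAi : Cardinal.mk (σ i '' A) < κ := by rwa [mk_image_equiv]
    have h1 : I (⋃ j ∈ Iio i, σ j '' A) (C ∪ σ i '' A) (σ i '' A ∪ B ∪ C) :=
      hI.base_monotonicity _ _ _ _ (hW _ _) (hU (hU hAi hB) hC) subset_union_left
        (union_subset subset_union_right (subset_union_left.trans subset_union_left)) hind
    have h2 := hI.monotonicity _ _ _ _ _ (hW _ _) (hU (hU hAi hB) hC) (hU hC hAi) Subset.rfl
      (subset_union_right.trans subset_union_left : B ⊆ σ i '' A ∪ B ∪ C) h1
    have h3 := hI.normality _ _ _ (hW _ _) hB (hU hC hAi) h2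
    have h4 : I (σ i '' A) C B := by
      have := hI.invariance _ _ _ hA hB hC (σ i) h
      rwa [image_eq_self fun x hx => hfix x (Or.inl hx),
        image_eq_self fun x hx => hfix x (Or.inr hx)] at this
    have h5 := hI.normality _ _ _ hAi hB hC h4
    rw [union_comm] at h5
    have h6 := hI.transitivity _ _ _ _ hB (hU (hW _ _) (hU hC hAi)) subset_union_left
      subset_union_right h3 h5
    refine hI.monotonicity _ _ _ _ _ (hU (hW _ _) (hU hC hAi)) hB hC ?_ Subset.rfl h6
    refine iUnion₂_subset fun j hj => ?_
    rcases (show j ≤ i from hj).lt_or_eq with hj | rfl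
    · exact (subset_biUnion_of_mem (u := fun j => σ j '' A) (show j ∈ Iio i from hj)).trans
        subset_union_left
    · exact subset_union_right.trans subset_union_right
  have hlt : ∀ i, I (⋃ j ∈ Iio i, σ j '' A) C B := by
    intro i
    induction i using (wellFounded_lt (α := J)).induction with
    | _ i ih =>
      -- A finite subset of the union below `i` already lies in the union up to some `j < i`, so
      -- limit stages need no separate treatment.
      refine hI.finite_character _ _ _ (hW _ _) hB hC fun A₀ hA₀ hA₀f => ?_
      rcases A₀.eq_empty_or_nonempty with rfl | hne
      · exact hI.monotonicity _ _ _ _ _ hA hB hC (empty_subset _) Subset.rfl h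
      · obtain ⟨j, hj, hA₀j⟩ : ∃ j < i, A₀ ⊆ ⋃ k ∈ Iic j, σ k '' A := by
          have : Nonempty J := ⟨i⟩
          have hex : ∀ x ∈ A₀, ∃ k, k < i ∧ x ∈ σ k '' A := fun x hx => by
            obtain ⟨k, hk, hx⟩ := mem_iUnion₂.1 (hA₀ hx)
            exact ⟨k, hk, hx⟩
          choose! k hk hkA using hex
          obtain ⟨x, hx, hmax⟩ := Set.exists_max_image A₀ k hA₀f hne
          exact ⟨k x, hk x hx, fun y hy => mem_biUnion (hmax y hy) (hkA y hy)⟩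
        exact hI.monotonicity _ _ _ _ _ (hW _ _) hB hC hA₀j Subset.rfl (hle j (ih j hj))
  have hall : Cardinal.mk (C ∪ ⋃ j ∈ (univ : Set J), σ j '' A : Set M) < κ := hU hC (hW _ _)
  obtain ⟨D, hD, hDμ, hBD⟩ := hμ _ hall
  obtain ⟨i, hi⟩ : ∃ i, D ⊆ C ∪ ⋃ j ∈ Iio i, σ j '' A := by
    have h1 : ∀ x : D, ∃ j, (x : M) ∈ C ∪ σ j '' A := by
      rintro ⟨x, hx⟩
      rcases hD hx with hx | hx
      · exact ⟨Classical.choice (Cardinal.mk_ne_zero_iff.1 (hJ ▸ hlam.pos.ne')), Or.inl hx⟩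
      · obtain ⟨j, -, hj⟩ := mem_iUnion₂.1 hx
        exact ⟨j, Or.inr hj⟩
    choose g hg using h1
    obtain ⟨i, hi⟩ := exists_forall_lt_of_mk_lt hlam
      (hDμ.trans (Order.lt_succ_of_le (le_max_left _ _))) g
    exact ⟨i, fun x hx => (hg ⟨x, hx⟩).imp id
      fun h => mem_biUnion (show g ⟨x, hx⟩ ∈ Iio i from hi _) h⟩
  obtain ⟨hfix, hind⟩ := hσ i (hlt i)
  have hAi : Cardinal.mk (σ i '' A) < κ := by rwa [mk_image_equiv]
  have hCi : Cardinal.mk (C ∪ ⋃ j ∈ Iio i, σ j '' A : Set M) < κ := hU hC (hW _ _)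
  -- The base found by local character is enlarged to `C` with the conjugates below `i`.
  -- Transitivity with the independence of those from the conjugate at `i` brings the base down to
  -- `C`.
  have h1 := hI.base_monotonicity _ _ _ _ hB hall hi
    (union_subset_union_right C (biUnion_subset_biUnion_left (subset_univ _))) hBD
  have h2 := hI.monotonicity _ _ _ _ _ hB hall hCi Subset.rfl
    ((subset_biUnion_of_mem (u := fun j => σ j '' A) (mem_univ i)).trans
      subset_union_right) h1
  have h3 := hI.normality _ _ _ hB hAi hCi h2
  have h4 := hI.monotonicity _ _ _ _ _ (hW _ _) (hU (hU hAi hB) hC) hC Subset.rfl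
    (subset_union_left.trans subset_union_left : σ i '' A ⊆ σ i '' A ∪ B ∪ C) hind
  have h5 := hI.normality _ _ _ (hW _ _) hAi hC h4
  rw [union_comm] at h5
  have h6 := hI.transitivity _ _ _ _ hAi (hU hB hCi) subset_union_left subset_union_right h3 h5
  have h7 := hI.monotonicity _ _ _ _ _ (hU hB hCi) hAi hC subset_union_left Subset.rfl h6
  have hfix' : ∀ x ∈ B ∪ C, (σ i).symm x = x := fun x hx => symm_apply_eq_self (hfix x hx)
  have h8 := hI.invariance _ _ _ hB hAi hC (σ i).symm h7
  rw [image_eq_self fun x hx => hfix' x (Or.inl hx),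
    image_eq_self fun x hx => hfix' x (Or.inr hx), image_image] at h8
  simpa using h8


/-! ### Chains of conjugates and full existence -/

theorem mk_biUnion_lt_of_finite (hκ : Cardinal.aleph0 ≤ κ) {J : Type*} {T : Set J} (hT : T.Finite)
    {W : J → Set M} (hW : ∀ j, Cardinal.mk (W j) < κ) : Cardinal.mk (⋃ j ∈ T, W j : Set M) < κ := by
  induction T, hT using Set.Finite.induction_on with
  | empty => simpa using (Cardinal.aleph0_pos.trans_le hκ)
  | insert _ _ ih =>
    rw [biUnion_insert]
    exact (Cardinal.mk_union_le _ _).trans_lt (Cardinal.add_lt_of_lt hκ (hW _) ih)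

/-- A chain of elements, each non-algebraic over the previous part, can be moved so that it
remains so over a given small set. -/
theorem IsBigModel.exists_equiv_chain_notMem_acl (hM : IsBigModel L κ M) {J : Type*} [LinearOrder J]
    (s : Finset J) {d : J → M} {Q W : J → Set M} {C X : Set M} (hX : Cardinal.mk X < κ)
    (hW : ∀ j, Cardinal.mk (W j) < κ) (hQW : ∀ j, Q j ⊆ W j) (hdW : ∀ j, d j ∈ W j)
    (hCQ : ∀ j ∈ s, C ⊆ Q j)
    (hd : ∀ j ∈ s, d j ∉ acl L (Q j ∪ ⋃ l ∈ {l | l ∈ s ∧ l < j}, W l)) :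
    ∃ ρ : M ≃[L] M, (∀ x ∈ C, ρ x = x) ∧
      ∀ j ∈ s, ρ (d j) ∉ acl L (ρ '' (Q j ∪ ⋃ l ∈ {l | l ∈ s ∧ l < j}, W l) ∪ X) := by
  induction s using Finset.induction_on_max with
  | empty => exact ⟨Language.Equiv.refl L M, by simp, by simp⟩
  | insert m s hm ih =>
    have hsm : {l | l ∈ insert m s ∧ l < m} = (s : Set J) := by
      ext l
      simp only [Finset.mem_insert, mem_ofPred_eq, Finset.mem_coe]
      exact ⟨fun h => h.1.resolve_left h.2.ne, fun h => ⟨Or.inr h, hm l h⟩⟩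
    have hsj : ∀ j ∈ s, {l | l ∈ insert m s ∧ l < j} = {l | l ∈ s ∧ l < j} := by
      intro j hj
      ext l
      simp only [Finset.mem_insert, mem_ofPred_eq]
      exact ⟨fun h => ⟨h.1.resolve_left (h.2.trans (hm j hj)).ne, h.2⟩,
        fun h => ⟨Or.inr h.1, h.2⟩⟩
    obtain ⟨ρ, hρC, hρ⟩ := ih (fun j hj => hCQ j (Finset.mem_insert_of_mem hj)) fun j hj => by
      have := hd j (Finset.mem_insert_of_mem hj)
      rwa [hsj j hj] at this
    have hdm := hd m (Finset.mem_insert_self m s)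
    rw [hsm] at hdm
    have hE : Cardinal.mk (Q m ∪ ⋃ l ∈ (s : Set J), W l : Set M) < κ :=
      hM.mk_union_lt ((Cardinal.mk_le_mk_of_subset (hQW m)).trans_lt (hW m))
        (mk_biUnion_lt_of_finite hM.aleph0_lt.le s.finite_toSet hW)
    -- `τ` fixes the images of all earlier sets `W l`, so what `ρ` achieved at earlier indices is
    -- kept while `d m` is moved off the closure with `X`.
    obtain ⟨τ, hτ, hτd⟩ := hM.exists_equiv_notMem_acl (A := ρ '' (Q m ∪ ⋃ l ∈ (s : Set J), W l))
      (a := ρ (d m)) (by rwa [mk_image_equiv]) hX (by rwa [mem_acl_image])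
    have hτ' : ∀ x ∈ Q m ∪ ⋃ l ∈ (s : Set J), W l, τ (ρ x) = ρ x := fun x hx =>
      hτ _ (mem_image_of_mem _ hx)
    have himg : ∀ Y ⊆ Q m ∪ ⋃ l ∈ (s : Set J), W l, (τ.comp ρ) '' Y = ρ '' Y := fun Y hY =>
      image_congr fun x hx => hτ' x (hY hx)
    refine ⟨τ.comp ρ, fun x hx => ?_, fun j hj => ?_⟩
    · rw [Language.Equiv.comp_apply,
        hτ' x (Or.inl (hCQ m (Finset.mem_insert_self m s) hx)), hρC x hx]
    · rcases Finset.mem_insert.1 hj with rfl | hj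
      · rw [hsm, himg _ Subset.rfl]
        exact hτd
      · have hWj : W j ⊆ ⋃ l ∈ (s : Set J), W l :=
          subset_biUnion_of_mem (u := W) (show j ∈ (s : Set J) from hj)
        rw [hsj j hj, himg, Language.Equiv.comp_apply, hτ' _ (Or.inr (hWj (hdW j)))]
        · exact hρ j hj
        · refine union_subset ((hQW j).trans (hWj.trans subset_union_right)) ?_
          exact (biUnion_subset_biUnion_left fun l hl => hl.1).trans subset_union_right

/-- Finite chains of conjugates of a small set `S` such that each conjugate of `d i` is
non-algebraic over the corresponding conjugate of `Q i` together with the preceding conjugates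
of `S`. -/
theorem IsBigModel.exists_chain (hM : IsBigModel L κ M) {J : Type*} [LinearOrder J]
    {ι : Type*} {S C : Set M} {Q : ι → Set M} {d : ι → M} {R : ι → (M ≃[L] M) → Prop}
    (hS : Cardinal.mk S < κ) (hCQ : ∀ i, C ⊆ Q i) (hQS : ∀ i, Q i ⊆ S) (hdS : ∀ i, d i ∈ S)
    (hd : ∀ i, d i ∉ acl L (Q i))
    (hR : ∀ τ : M ≃[L] M, (∀ x ∈ C, τ x = x) → ∃ i, R i τ) (s : Finset J) :
    ∃ (τ : J → (M ≃[L] M)) (i : J → ι), ∀ j ∈ s, (∀ x ∈ C, τ j x = x) ∧ R (i j) (τ j) ∧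
      τ j (d (i j)) ∉ acl L (τ j '' Q (i j) ∪ ⋃ l ∈ {l | l ∈ s ∧ l < j}, τ l '' S) := by
  classical
  induction s using Finset.induction_on_min with
  | empty =>
    obtain ⟨i, -⟩ := hR (Language.Equiv.refl L M) (by simp)
    exact ⟨fun _ => Language.Equiv.refl L M, fun _ => i, by simp⟩
  | insert m s hm ih =>
    obtain ⟨τ, i, h⟩ := ih
    -- The chain grows at its lower end. Moving the old chain by `ρ` makes it non-algebraic over `S`
    -- as well; pulling back by `ρ⁻¹` leaves the old terms, and hence their relations `R`, untouched
    -- and puts `ρ⁻¹ S` in front.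
    obtain ⟨ρ, hρC, hρ⟩ := hM.exists_equiv_chain_notMem_acl s (d := fun j => τ j (d (i j)))
      (Q := fun j => τ j '' Q (i j)) (W := fun j => τ j '' S) (C := C) hS
      (fun j => by rwa [mk_image_equiv]) (fun j => image_mono (hQS _))
      (fun j => mem_image_of_mem _ (hdS _))
      (fun j hj x hx => ⟨x, hCQ _ hx, (h j hj).1 x hx⟩) (fun j hj => (h j hj).2.2)
    have hρC' : ∀ x ∈ C, ρ.symm x = x := fun x hx => symm_apply_eq_self (hρC x hx)
    obtain ⟨i₀, hi₀⟩ := hR ρ.symm hρC'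
    refine ⟨Function.update τ m ρ.symm, Function.update i m i₀, fun j hj => ?_⟩
    rcases Finset.mem_insert.1 hj with rfl | hj
    · have he : {l | l ∈ insert j s ∧ l < j} = ∅ := by
        ext l
        simp only [Finset.mem_insert, mem_ofPred_eq, mem_empty_iff_false, iff_false, not_and]
        rintro (rfl | hl)
        · exact lt_irrefl _
        · exact (hm l hl).not_gt
      simp only [Function.update_self, he, biUnion_empty, union_empty, mem_acl_image]
      exact ⟨hρC', hi₀, hd i₀⟩
    · have hjm : j ≠ m := (hm j hj).ne'
      simp only [Function.update_of_ne hjm]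
      refine ⟨(h j hj).1, (h j hj).2.1, fun hmem => hρ j hj ?_⟩
      rw [← mem_acl_image (σ := ρ)] at hmem
      refine acl_mono ?_ hmem
      rw [image_union, image_union, union_assoc]
      refine union_subset_union_right _ ?_
      rintro _ ⟨x, hx, rfl⟩
      obtain ⟨l, ⟨hl, hlj⟩, hxl⟩ := mem_iUnion₂.1 hx
      rcases Finset.mem_insert.1 hl with rfl | hls
      · rw [Function.update_self] at hxl
        obtain ⟨y, hy, rfl⟩ := hxl
        right
        simpa using hy
      · rw [Function.update_of_ne (hm l hls).ne'] at hxl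
        exact Or.inl (mem_image_of_mem _ (mem_biUnion (show l ∈ {l | l ∈ s ∧ l < j} from
          ⟨hls, hlj⟩) hxl))

theorem Definable.comp_mem {ι : Type*} {A : Set M} {E : Set (ι → M)} (hE : A.Definable L E)
    {σ : M ≃[L] M} (hσ : ∀ a ∈ A, σ a = a) {v : ι → M} (hv : v ∈ E) : σ ∘ v ∈ E := by
  obtain ⟨φ, rfl⟩ := Set.definable_iff_exists_formula_sum.1 hE
  have := (Language.StrongHomClass.realize_formula σ φ).2 hv
  rw [mem_ofPred_eq]
  convert this using 1
  funext p
  rcases p with p | p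
  · exact (hσ p p.2).symm
  · rfl

/-- Local character of M-dividing independence excludes arbitrarily long finite chains of
definable dependence. -/
theorem false_of_chain (hM : IsBigModel L κ M)
    {A S C : Set M} (hA : Cardinal.mk A < κ) (hS : Cardinal.mk S < κ)
    {μ : Cardinal.{w}} (hμκ : μ < κ) (hμ : ∀ B : Set M, Cardinal.mk B < κ →
      ∃ C : Set M, C ⊆ B ∧ Cardinal.mk C < μ ∧ MIndep L A C B)
    {ι : Type*} [Finite ι] {Q : ι → Set M} {d : ι → M}
    (hCQ : ∀ i, C ⊆ Q i) (hQS : ∀ i, Q i ⊆ S) (hdS : ∀ i, d i ∈ S)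
    (hd : ∀ i, d i ∉ acl L (Q i))
    (E : ∀ i, Set ((A ⊕ Q i) ⊕ Unit → M)) (n : ι → ℕ)
    (hE : ∀ i, (∅ : Set M).Definable L (E i))
    (hn : ∀ i, ∀ v : A ⊕ Q i → M, {y : M | Sum.elim v (fun _ => y) ∈ E i}.encard ≤ n i)
    (hR : ∀ τ : M ≃[L] M, (∀ x ∈ C, τ x = x) → ∃ i,
      (Sum.elim (Sum.elim (fun a : A => (a : M)) fun c : Q i => τ c) fun _ => τ (d i)) ∈ E i) :
    False := by
  classical
  let ν : Cardinal.{w} := max μ Cardinal.aleph0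
  let lam : Cardinal.{w} := Order.succ ν
  have hlam : lam.IsRegular := Cardinal.isRegular_succ (le_max_right _ _)
  have hlamκ : lam < κ := hM.strongLimit.isSuccLimit.succ_lt (max_lt hμκ hM.aleph0_lt)
  let J := lam.ord.ToType
  have hJ : Cardinal.mk J = lam := by simp [J]
  choose τ i hτ using hM.exists_chain (J := J) hS hCQ hQS hdS hd hR
  -- The relation attached to an index depends on the finite chain. As `ι` is finite, a single
  -- choice `χ` agrees on each finite set with the choice made by some larger chain.
  obtain ⟨χ, hχ⟩ := Finset.rado_selection (β := fun _ => ι) i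
  let V := J × S
  have hV : Cardinal.mk V < κ := by
    rw [Cardinal.mk_prod, Cardinal.lift_id, Cardinal.lift_id]
    exact Cardinal.mul_lt_of_lt hM.aleph0_lt.le (hJ ▸ hlamκ) hS
  let δ : J → V := fun j => (j, ⟨d (χ j), hdS _⟩)
  let q : ∀ j : J, Q (χ j) → V := fun j c => (j, ⟨c, hQS _ c.2⟩)
  let K : Set J → J → Set V := fun T j => range (q j) ∪ {p | p.1 ∈ T ∧ p.1 < j}
  have hKmono : ∀ {T T' : Set J} (j), T ⊆ T' → K T j ⊆ K T' j := fun j h =>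
    union_subset_union_right _ fun p hp => ⟨h hp.1, hp.2⟩
  let f : ∀ j : J, (A ⊕ Q (χ j)) ⊕ Unit → A ⊕ V := fun j =>
    Sum.elim (Sum.elim Sum.inl fun c => Sum.inr (q j c)) fun _ => Sum.inr (δ j)
  let P₁ : J → Set (V → M) := fun j =>
    {w | Sum.elim (fun a : A => (a : M)) w ∘ f j ∈ E (χ j)}
  let P₂ : Finset J → J → Set (V → M) := fun s j =>
    {w | w (δ j) ∉ acl L (∅ ∪ w '' K s j)}
  have hP₁ : ∀ j, A.Definable L (P₁ j) := fun j => by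
    have := Definable.curry (fun a : A => (a : M)) ((hE (χ j)).preimage_comp (f j))
    rwa [empty_union, Subtype.range_coe] at this
  -- The limit need not consist of conjugates of `S`: only dependence on `A` and non-algebraicity
  -- over the base and earlier copies are retained, and these are type-definable.
  obtain ⟨w, hw⟩ := hM.saturated.iInter_nonempty_pi hM.aleph0_lt.le hA hV
    (P := fun s : Finset J => ⋂ j : s, (P₁ j ∩ P₂ s j))
    (fun s => .iInter fun j => .inter (.of_definable (hP₁ j))
      ((isTypeDefinable_notMem_acl ∅ _ _).mono (empty_subset _)))
    (fun F => by
      obtain ⟨t, hst, ht⟩ := hχ (F.biUnion id)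
      refine ⟨fun p => τ t p.1 p.2, fun s hs => mem_iInter.2 fun j => ?_⟩
      have hjF : (j : J) ∈ F.biUnion id := Finset.mem_biUnion.2 ⟨s, hs, j.2⟩
      obtain ⟨-, h1, h2⟩ := hτ t j (hst hjF)
      have hj := ht j hjF
      rw [← hj] at h1 h2
      constructor
      · have : Sum.elim (fun a : A => (a : M)) (fun p : V => τ t p.1 p.2) ∘ f j =
            Sum.elim (Sum.elim (fun a : A => (a : M)) fun c : Q (χ j) => τ t j c) fun _ => τ t j (d (χ j)) := by
          funext p
          rcases p with (p | p) | p <;> rfl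
        rw [mem_ofPred_eq, this]
        exact h1
      · refine fun hmem => h2 (acl_mono ?_ hmem)
        rintro _ (h | ⟨p, ⟨c, rfl⟩ | ⟨hp, hpj⟩, rfl⟩)
        · exact h.elim
        · exact Or.inl ⟨c, c.2, rfl⟩
        · exact Or.inr (mem_biUnion (show p.1 ∈ {l | l ∈ t ∧ l < j} from
            ⟨hst (Finset.mem_biUnion.2 ⟨s, hs, hp⟩), hpj⟩) ⟨p.2, p.2.2, rfl⟩))
  have hw₁ : ∀ j, w ∈ P₁ j := fun j =>
    (mem_iInter.1 (mem_iInter.1 hw {j}) ⟨j, Finset.mem_singleton_self j⟩).1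
  have hw₂ : ∀ j, w (δ j) ∉ acl L (w '' K univ j) := by
    intro j hmem
    obtain ⟨F, hF, hFf, hmemF⟩ := exists_finite_of_mem_acl hmem
    have : Nonempty V := ⟨δ j⟩
    choose! g hgK hgw using fun x (hx : x ∈ F) => hF hx
    have hs := (mem_iInter.1 (mem_iInter.1 hw (insert j (hFf.toFinset.image fun x => (g x).1)))
      ⟨j, Finset.mem_insert_self _ _⟩).2
    refine hs (acl_mono (fun x hx => Or.inr ⟨g x, ?_, hgw x hx⟩) hmemF)
    refine (hgK x hx).imp id fun h => ⟨?_, h.2⟩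
    exact Finset.mem_insert_of_mem (Finset.mem_image_of_mem _ (hFf.mem_toFinset.2 hx))
  -- The base `D` lies in the copies below some `j`. Independence of `A` over these and the `j`-th
  -- base would make `w (δ j)` algebraic over them.
  obtain ⟨D, hD, hDμ, hAD⟩ := hμ (range w) (Cardinal.mk_range_le.trans_lt hV)
  choose g hg using fun x : D => hD x.2
  obtain ⟨j, hj⟩ := exists_forall_lt_of_mk_lt hlam
    (hDμ.trans (Order.lt_succ_of_le (le_max_left _ _))) fun x => (g x).1
  refine hw₂ j (mIndep_iff.1 hAD (w '' K univ j) ?_ ?_ _ ?_ ?_)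
  · exact fun x hx => ⟨g ⟨x, hx⟩, Or.inr ⟨mem_univ _, hj _⟩, hg _⟩
  · exact (image_subset_range _ _).trans (subset_union_left.trans (subset_acl _))
  · have : w (δ j) ∈ acl L (∅ ∪ range (Sum.elim (fun a : A => (a : M)) fun c => w (q j c))) := by
      refine mem_acl_union_range.2 ⟨E (χ j), n (χ j), hE _, hn _, ?_⟩
      have h := hw₁ j
      rw [mem_ofPred_eq] at h
      convert h using 1
      funext p
      rcases p with (p | p) | p <;> rfl
    refine acl_mono ?_ this
    rintro _ (h | ⟨p | p, rfl⟩)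
    · exact h.elim
    · exact Or.inl p.2
    · exact Or.inr ⟨_, Or.inl (mem_range_self p), rfl⟩
  · exact subset_acl _ (Or.inl (mem_range_self _))


/-- Full existence for M-dividing independence, from local character. -/
theorem exists_equiv_mIndep (hM : IsBigModel L κ M)
    {A B C : Set M} (hA : Cardinal.mk A < κ) (hB : Cardinal.mk B < κ) (hC : Cardinal.mk C < κ)
    {μ : Cardinal.{w}} (hμκ : μ < κ) (hμ : ∀ B : Set M, Cardinal.mk B < κ →
      ∃ C : Set M, C ⊆ B ∧ Cardinal.mk C < μ ∧ MIndep L A C B) :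
    ∃ σ : M ≃[L] M, (∀ x ∈ C, σ x = x) ∧ MIndep L (σ '' A) C B := by
  classical
  by_contra! hno
  let S : Set M := acl L (B ∪ C)
  have hS : Cardinal.mk S < κ := hM.mk_acl_lt (hM.mk_union_lt hB hC)
  have hCS : C ⊆ S := subset_union_right.trans (subset_acl _)
  -- Each such set avoids one possible witness of dependence. A tuple in all members of `𝒟` is a
  -- conjugate of `A` over `C` with no witness left.
  let Div : Set (A → M) → Prop := fun D => ∃ (Q : Set M) (d : M) (E : Set ((A ⊕ Q) ⊕ Unit → M))
    (n : ℕ), C ⊆ Q ∧ Q ⊆ S ∧ d ∈ S ∧ d ∉ acl L Q ∧ (∅ : Set M).Definable L E ∧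
    (∀ v : A ⊕ Q → M, {y : M | Sum.elim v (fun _ => y) ∈ E}.encard ≤ n) ∧
    D = {v | Sum.elim (Sum.elim v (fun c : Q => (c : M))) (fun _ => d) ∉ E}
  let 𝒟 : Set (Set (A → M)) :=
    {D | (C.Definable L D ∧ (fun a : A => (a : M)) ∈ D) ∨ Div D}
  have h𝒟 : ∀ D ∈ 𝒟, S.Definable L D := by
    rintro D (⟨hD, -⟩ | ⟨Q, d, E, n, -, hQ, hd, -, hE, -, rfl⟩)
    · exact hD.mono hCS
    · let c : Q ⊕ Unit → M := Sum.elim (↑) fun _ => d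
      let f : (A ⊕ Q) ⊕ Unit → (Q ⊕ Unit) ⊕ A :=
        Sum.elim (Sum.elim Sum.inr fun c => Sum.inl (Sum.inl c)) fun _ => Sum.inl (Sum.inr ())
      have h := (Definable.curry c (hE.preimage_comp f)).compl
      have hc : ∅ ∪ range c ⊆ S := by
        rintro _ (h | ⟨p | p, rfl⟩)
        · exact h.elim
        · exact hQ p.2
        · exact hd
      convert h.mono hc using 1
      ext v
      have : Sum.elim c v ∘ f = Sum.elim (Sum.elim v (fun c : Q => (c : M))) fun _ => d := by
        funext p
        rcases p with (p | p) | p <;> rfl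
      rw [mem_compl_iff, mem_ofPred_eq, mem_ofPred_eq, mem_preimage, this]
  obtain ⟨T, hT𝒟, hTf, hTe⟩ : ∃ T ⊆ 𝒟, T.Finite ∧ ⋂₀ T = ∅ := by
    by_contra! h
    obtain ⟨v, hv⟩ := hM.saturated.sInter_nonempty_pi hM.aleph0_lt.le hS hA h𝒟 h
    obtain ⟨σ, hσC, hσv⟩ := hM.homogeneous.exists_equiv_over hM.aleph0_lt.le hA hC
      (c := fun a : A => (a : M)) (c' := v) fun D hD hcD => hv D (Or.inl ⟨hD, hcD⟩)
    refine hno σ hσC (mIndep_iff.2 fun Q hCQ hQS x hxA hxB => ?_)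
    by_contra hxQ
    have hx : x ∈ acl L (∅ ∪ range (Sum.elim v fun c : Q => (c : M))) := by
      refine acl_mono ?_ hxA
      rintro _ (⟨a, ha, rfl⟩ | hy)
      · exact Or.inr ⟨Sum.inl ⟨a, ha⟩, (hσv ⟨a, ha⟩).symm⟩
      · exact Or.inr ⟨Sum.inr ⟨_, hy⟩, rfl⟩
    obtain ⟨E, n, hE, hn, hxE⟩ := mem_acl_union_range.1 hx
    refine hv _ (Or.inr ⟨Q, x, E, n, hCQ, hQS, ?_, hxQ, hE, hn, rfl⟩) hxE
    exact acl_subset_acl (union_subset (subset_union_left.trans (subset_acl _)) hQS) hxB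
  have hfin : Finite {D // D ∈ T ∧ Div D} := (hTf.subset (sep_subset T Div)).to_subtype
  choose Q d E n hCQ hQS hdS hd hE hn hD using fun D : {D // D ∈ T ∧ Div D} => D.2.2
  -- For `τ` fixing `C`, the copy `τ⁻¹ A` keeps the type over `C`, so it must violate a dividing
  -- condition in `T`. Applying `τ` turns this into a dependence of `τ d` on `A` and `τ Q`.
  refine false_of_chain hM hA hS hμκ hμ hCQ hQS hdS hd E n hE hn fun τ hτ => ?_
  have hτ' : ∀ x ∈ C, τ.symm x = x := fun x hx => symm_apply_eq_self (hτ x hx)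
  have hnot : (τ.symm ∘ fun a : A => (a : M)) ∉ ⋂₀ T := by
    rw [hTe]
    exact notMem_empty _
  rw [mem_sInter] at hnot
  push Not at hnot
  obtain ⟨D, hDT, hτD⟩ := hnot
  have hDiv : Div D := (hT𝒟 hDT).resolve_left fun h =>
    hτD (Definable.comp_mem h.1 hτ' h.2)
  refine ⟨⟨D, hDT, hDiv⟩, ?_⟩
  have h1 : (τ.symm ∘ fun a : A => (a : M)) ∉ (⟨D, hDT, hDiv⟩ : {D // D ∈ T ∧ Div D}).1 := hτD
  rw [hD, mem_ofPred_eq, not_not] at h1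
  have h2 := (Definable.comp_mem_iff (hE _) τ _).2 h1
  convert h2 using 1
  funext p
  rcases p with (p | p) | p <;> simp

/-! ### Local character from symmetry -/

theorem exists_subset_of_finite_of_subset_iUnion {α : Type*} {C : ℕ → Set α} (hC : Monotone C)
    {F : Set α} (hF : F.Finite) (h : F ⊆ ⋃ n, C n) : ∃ n, F ⊆ C n := by
  choose! f hf using fun x (hx : x ∈ F) => mem_iUnion.1 (h hx)
  obtain ⟨n, hn⟩ := (hF.image f).bddAbove
  exact ⟨n, fun x hx => hC (hn (mem_image_of_mem f hx)) (hf x hx)⟩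

/-- Local character of M-dividing independence, from symmetry. -/
theorem IsSymmetric.local_character (hM : IsBigModel L κ M)
    (hsymm : IsSymmetric κ (MIndep L (M := M))) {A : Set M} (hA : Cardinal.mk A < κ) :
    ∃ μ : Cardinal.{w}, μ < κ ∧ ∀ B : Set M, Cardinal.mk B < κ →
      ∃ C : Set M, C ⊆ B ∧ Cardinal.mk C < μ ∧ MIndep L A C B := by
  classical
  obtain ⟨ν₀, hν₀, hν₀κ, hacl⟩ := hM.exists_mk_acl_le
  let ν := max ν₀ (Cardinal.mk A)
  have hν : Cardinal.aleph0 ≤ ν := hν₀.trans (le_max_left _ _)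
  refine ⟨Order.succ ν, hM.strongLimit.isSuccLimit.succ_lt (max_lt hν₀κ hA), fun B hB => ?_⟩
  have hwit : ∀ (l : List M) (x : M), ∃ b : Set M, b ⊆ B ∧ b.Finite ∧
      (x ∈ acl L (B ∪ {y | y ∈ l}) → x ∈ acl L (b ∪ {y | y ∈ l})) := by
    intro l x
    by_cases hx : x ∈ acl L (B ∪ {y | y ∈ l})
    · obtain ⟨F, hF, hFf, hxF⟩ := exists_finite_of_mem_acl hx
      exact ⟨F ∩ B, inter_subset_right, hFf.subset inter_subset_left, fun _ =>
        acl_mono (fun y hy => (hF hy).imp (fun h => ⟨hy, h⟩) id) hxF⟩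
    · exact ⟨∅, empty_subset _, finite_empty, fun h => (hx h).elim⟩
  choose b hbB hbf hb using hwit
  -- Adds finite witnesses in `B` for every algebraicity over `B` and a finite tuple, with tuple and
  -- element in `acl (A ∪ C)`. Sizes stay at most `ν`, which depends on `A` and not on `B`.
  let step : Set M → Set M := fun C =>
    C ∪ ⋃ p : List (acl L (A ∪ C)) × acl L (A ∪ C), b (p.1.map (↑)) p.2
  let C : ℕ → Set M := fun n => step^[n] ∅
  have hCs : ∀ n, C (n + 1) = step (C n) := fun n => Function.iterate_succ_apply' step n ∅
  have hCmono : Monotone C := monotone_nat_of_le_succ fun n => by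
    rw [hCs]; exact subset_union_left
  have hCB : ∀ n, C n ⊆ B := by
    intro n
    induction n with
    | zero => exact empty_subset _
    | succ n ih =>
      rw [hCs]
      exact union_subset ih (iUnion_subset fun p => hbB _ _)
  have hCν : ∀ n, Cardinal.mk (C n) ≤ ν := by
    intro n
    induction n with
    | zero => simp [C]
    | succ n ih =>
      rw [hCs]
      have h1 : Cardinal.mk (acl L (A ∪ C n)) ≤ ν :=
        (hacl _).trans (max_le (le_max_left _ _) ((Cardinal.mk_union_le _ _).trans
          (Cardinal.add_le_of_le hν (le_max_right _ _) ih)))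
      have h2 : Cardinal.mk (List (acl L (A ∪ C n)) × acl L (A ∪ C n)) ≤ ν := by
        rw [Cardinal.mk_prod, Cardinal.lift_id, Cardinal.lift_id]
        exact Cardinal.mul_le_of_le hν
          ((Cardinal.mk_list_le_max _).trans (max_le hν h1)) h1
      refine (Cardinal.mk_union_le _ _).trans (Cardinal.add_le_of_le hν ih ?_)
      exact (Cardinal.mk_iUnion_le _).trans (Cardinal.mul_le_of_le hν h2
        (ciSup_le' fun p => (hbf _ _).lt_aleph0.le.trans hν))
  have hUB : (⋃ n, C n) ⊆ B := iUnion_subset hCB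
  have hUκ : Cardinal.mk (⋃ n, C n) < κ := (Cardinal.mk_le_mk_of_subset hUB).trans_lt hB
  -- Symmetry reduces the claim to independence of `B` from `A`, where `C'` lies in `acl (A ∪ ⋃ n, C
  -- n)`; this is the set that the construction took care of.
  refine ⟨⋃ n, C n, hUB, Order.lt_succ_of_le ?_, (hsymm _ _ _ hA hB hUκ).2 ?_⟩
  · rw [← Equiv.ulift.{w}.surjective.iUnion_comp]
    refine (Cardinal.mk_iUnion_le _).trans (Cardinal.mul_le_of_le hν ?_ (ciSup_le' fun n => hCν _))
    simpa using hν
  · rw [mIndep_iff]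
    intro C' hCC' hC' x hxB hxA
    have hlevel : ∀ y ∈ acl L (A ∪ ⋃ n, C n), ∃ n, y ∈ acl L (A ∪ C n) := by
      intro y hy
      obtain ⟨F, hF, hFf, hyF⟩ := exists_finite_of_mem_acl hy
      have hF' : F ⊆ ⋃ n, (A ∪ C n) := by rwa [← union_iUnion]
      obtain ⟨n, hn⟩ := exists_subset_of_finite_of_subset_iUnion
        (fun m n h => union_subset_union_right A (hCmono h)) hFf hF'
      exact ⟨n, acl_mono hn hyF⟩
    have hxU : x ∈ acl L (A ∪ ⋃ n, C n) :=
      acl_subset_acl (union_subset (subset_union_left.trans (subset_acl _)) hC') hxA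
    obtain ⟨F, hF, hFf, hxF⟩ := exists_finite_of_mem_acl hxB
    let G := F ∩ C'
    have hGf : G.Finite := hFf.subset inter_subset_left
    have hG : insert x G ⊆ ⋃ n, acl L (A ∪ C n) := by
      rintro y (rfl | hy)
      · exact mem_iUnion.2 (hlevel _ hxU)
      · exact mem_iUnion.2 (hlevel _ (hC' hy.2))
    -- The element and the finitely many parameters from `C'` appear at one stage `n`, so their
    -- witnesses lie in stage `n + 1`.
    obtain ⟨n, hn⟩ := exists_subset_of_finite_of_subset_iUnion
      (fun m n h => acl_mono (union_subset_union_right A (hCmono h))) (hGf.insert x) hG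
    let l : List M := hGf.toFinset.toList
    have hl : ∀ y, y ∈ l ↔ y ∈ G := by simp [l]
    obtain ⟨l', hl'⟩ : ∃ l' : List (acl L (A ∪ C n)), l'.map (↑) = l :=
      ⟨l.pmap (fun y hy => ⟨y, hy⟩) fun y hy => hn (Or.inr ((hl y).1 hy)), by
        rw [List.map_pmap, List.pmap_eq_map]
        exact List.map_id _⟩
    have hbC : b l x ⊆ C (n + 1) := by
      rw [hCs]
      refine Subset.trans ?_ subset_union_right
      have := subset_iUnion (fun p : List (acl L (A ∪ C n)) × acl L (A ∪ C n) =>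
        b (p.1.map (↑)) p.2) (l', ⟨x, hn (mem_insert x G)⟩)
      rwa [hl'] at this
    refine acl_mono ?_ (hb l x (acl_mono (fun y hy => ?_) hxF))
    · refine union_subset (hbC.trans ((subset_iUnion C _).trans hCC')) fun y hy => ?_
      exact ((hl y).1 hy).2
    · exact (hF hy).imp id fun h => (hl y).2 ⟨hy, h⟩

/-! ### Verification of the axioms -/

theorem IsSymmetric.isIndependenceRelation (hM : IsBigModel L κ M)
    (hsymm : IsSymmetric κ (MIndep L (M := M))) :
    IsIndependenceRelation L κ (MIndep L (M := M)) where
  invariance _ _ _ _ _ _ σ h := h.image σ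
  monotonicity _ _ _ _ _ _ _ _ hA hB h := h.mono hA hB
  base_monotonicity _ _ _ _ _ _ hD hC h :=
    h.base_mono hD ((hC.trans subset_union_left).trans (subset_acl _))
  transitivity _ _ _ _ _ _ hD _ h₁ h₂ := h₁.trans hD h₂
  normality _ _ _ _ _ _ h := h.normal
  -- Full existence over `B ∪ C` gives a conjugate independent from `B'` over `B ∪ C`. After
  -- exchanging sides, transitivity lowers the base to `C`.
  extension A B C B' hA hB' hC hBB' h := by
    have hB : Cardinal.mk B < κ := (Cardinal.mk_le_mk_of_subset hBB').trans_lt hB'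
    have hBC := hM.mk_union_lt hB hC
    obtain ⟨μ, hμκ, hμ⟩ := hsymm.local_character hM hA
    obtain ⟨σ, hσ, hσA⟩ := exists_equiv_mIndep hM hA hB' hBC hμκ hμ
    have hA' : Cardinal.mk (σ '' A) < κ := by rwa [mk_image_equiv]
    refine ⟨σ, hσ, ?_⟩
    have h1 := h.image σ
    rw [image_eq_self fun x hx => hσ x (Or.inl hx), image_eq_self fun x hx => hσ x (Or.inr hx)] at h1
    have h2 := ((hsymm _ _ _ hA' hB hC).1 h1).normal
    have h3 := ((hsymm _ _ _ hA' hB' hBC).1 hσA)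
    exact (hsymm _ _ _ hA' hB' hC).2 (h3.trans subset_union_right h2)
  finite_character _ _ _ _ _ _ h := mIndep_of_finite h
  local_character _ hA := hsymm.local_character hM hA

end
end ModelIndep

theorem mainTheorem7 (L : FirstOrder.Language.{u, v}) (T : L.Theory) (hT : T.IsComplete)
    (κ : Cardinal.{w}) (M : Type w) [L.Structure M] [Nonempty M] [M ⊨ T]
    (hM : ModelIndep.IsBigModel L κ M) :
    (ModelIndep.IsIndependenceRelation L κ (ModelIndep.MIndep L (M := M)) ↔
      ModelIndep.IsSymmetric κ (ModelIndep.MIndep L (M := M))) ∧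
    (ModelIndep.IsStrictIndependenceRelation L κ (ModelIndep.MIndep L (M := M)) ↔
      ModelIndep.IsSymmetric κ (ModelIndep.MIndep L (M := M))) := by
  have hsymm : ModelIndep.IsIndependenceRelation L κ (ModelIndep.MIndep L (M := M)) →
      ModelIndep.IsSymmetric κ (ModelIndep.MIndep L (M := M)) := fun h A B C hA hB hC =>
    ⟨h.symm hM.strongLimit hM.aleph0_lt hA hB hC, h.symm hM.strongLimit hM.aleph0_lt hB hA hC⟩
  exact ⟨⟨hsymm, fun h => h.isIndependenceRelation hM⟩, fun h => hsymm h.toIsIndependenceRelation,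
    fun h => ⟨h.isIndependenceRelation hM, fun _ _ _ h => h.mem_acl⟩⟩
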